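/- Let $d\ge 3$, and let $\Omega_n$ be the probability space of bipartite multigraphs on $V_1\cup V_2$, $|V_1|=|V_2|=n$, obtained as the union of $d$ independent uniformly random perfect matchings between $V_1$ and $V_2$. For even $i\ge 2$ let $X_i$ be the number of cycles of length $i$ (a cycle of length $2$ is a pair of parallel edges), let $r(d,i)$ be the number of proper edge colourings of a cycle of length $i$ with $d$ colours, and put $\lambda_i=r(d,i)/i$. Let $\alpha,\beta\ge 0$ with $\alpha+\beta<1$ be such that $\alpha n$ and $\beta n$ are integers for infinitely many $n$; below, limits of quantities that involve $Y$ are taken along these $n$. Let $Y$ be the number of independent sets with exactly $\alpha n$ vertices in $V_1$ and $\beta n$ vertices in $V_2$, and put $$\delta_i=\left(\frac{\alpha\beta}{(1-\alpha)(1-\beta)}\right)^{i/2}.$$ (a) For each $k\ge 1$, $X_2,X_4,\dots,X_{2k}$ are asymptotically independent Poisson variables as $n\to\infty$, with $\mathbf E X_{2j}\to\lambda_{2j}$; that is, $\mathbf P(X_2=a_1,\dots,X_{2k}=a_k)\to\prod_{j=1}^k e^{-\lambda_{2j}}\lambda_{2j}^{a_j}/a_j!$ for all integers $a_1,\dots,a_k\ge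 0$. (b) For every even $i\ge 2$, $\mathbf E(YX_i)/\mathbf E Y\to\lambda_i(1+\delta_i)$. Moreover $1+\delta_i=\frac12 x^i\,\mathrm{tr}(A^i)$, where $x=\frac{1-\alpha-\beta}{\sqrt{(1-\alpha)(1-\beta)}}$, $y=\frac{\alpha(1-\alpha)}{(1-\alpha-\beta)^2}$, $z=\frac{\beta(1-\beta)}{(1-\alpha-\beta)^2}$ and $$A=\begin{pmatrix}0&0&0&1\\0&0&y&1\\0&1&0&0\\z&1&0&0\end{pmatrix}.$$ (c) For all integers $m_1,\dots,m_k\ge 0$, with $[x]_m=x(x-1)\cdots(x-m+1)$, $$\frac{\mathbf E\big(Y[X_2]_{m_1}\cdots[X_{2k}]_{m_k}\big)}{\mathbf E Y}\to\prod_{j=1}^k\big(\lambda_{2j}(1+\delta_{2j})\big)^{m_j}.$$ (d) Suppose in addition that $\alpha,\beta$ are such that $\mathbf E[Y^2]/(\mathbf E Y)^2\to\tau$, where $$\tau=\frac{(1-\alpha-\beta+\alpha\beta)^d}{(1-\alpha-\beta+2\alpha\beta)^{(d-1)/2}(1-\alpha-\beta)^{(d-1)/2}\sqrt{1-\alpha-\beta+d\alpha\beta}\,\sqrt{1-\alpha-\beta-(d-2)\alpha\beta}}$$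 (with $\sqrt{1-\alpha-\beta-(d-2)\alpha\beta}$ real and positive). Then $Y$ and $(X_i)_{i\text{ even}}$ satisfy all hypotheses of the small subgraph conditioning theorem with these $\lambda_i$ and $\delta_i$: $\lambda_i>0$, $\delta_i>-1$, $Y\ge 0$, $\mathbf E Y>0$ for all large $n$, (a) and (c) hold along the admissible $n$, $\sum_{i\text{ even}}\lambda_i\delta_i^2<\infty$, and $\mathbf E[Y^2]/(\mathbf E Y)^2\le\exp\big(\sum_{i\text{ even}}\lambda_i\delta_i^2\big)+o(1)$. -/

import Mathlib

open Filter Topology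
open scoped BigOperators

noncomputable section

namespace BipartiteHardCore

/-- The sample space of the random bipartite `d`-regular multigraph on `V₁ = V₂ = Fin n`: a point is
a `d`-tuple of perfect matchings, the `k`-th of which joins `u ∈ V₁` to `σ k u ∈ V₂`. It carries the
uniform distribution, so expectations are the averages `𝔼 σ, f σ`. -/
abbrev Matchings (d n : ℕ) : Type := Fin d → Equiv.Perm (Fin n)

/-- The edges of the multigraph: `(k, u)` is the edge of the `k`-th matching at `u ∈ V₁`. -/
abbrev Edge (d n : ℕ) : Type := Fin d × Fin n

/-- The two endpoints of an edge; `Sum.inl` is `V₁` and `Sum.inr` is `V₂`. -/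
def ends {d n : ℕ} (σ : Matchings d n) (e : Edge d n) : Sym2 (Fin n ⊕ Fin n) :=
  s(Sum.inl e.2, Sum.inr (σ e.1 e.2))

/-- `C` is the edge set of a cycle of length `ℓ`: there are distinct vertices `v₀, …, v_{ℓ-1}` and
distinct edges `e₀, …, e_{ℓ-1}` with `e_t` joining `v_t` and `v_{t+1 mod ℓ}`, and `C` is the set of
the `e_t`. In particular a cycle of length two is a pair of parallel edges. -/
def IsCycle {d n : ℕ} (σ : Matchings d n) (ℓ : ℕ) (C : Finset (Edge d n)) : Prop :=
  ∃ (v : Fin ℓ → Fin n ⊕ Fin n) (e : Fin ℓ → Edge d n),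
    Function.Injective v ∧ Function.Injective e ∧
    (∀ t, ends σ (e t) = s(v t, v (finRotate ℓ t))) ∧
    C = Finset.univ.image e

/-- The number of cycles of length `ℓ`. -/
def numCycles {d n : ℕ} (ℓ : ℕ) (σ : Matchings d n) : ℕ :=
  {C : Finset (Edge d n) | IsCycle σ ℓ C}.ncard

/-- The number of independent sets `S ∪ T`, `S ⊆ V₁`, `T ⊆ V₂`, with `|S| = α n` and `|T| = β n`. -/
def numIndep {d n : ℕ} (α β : ℝ) (σ : Matchings d n) : ℕ :=
  {p : Finset (Fin n) × Finset (Fin n) |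
    (p.1.card : ℝ) = α * n ∧ (p.2.card : ℝ) = β * n ∧
      ∀ k, ∀ u ∈ p.1, σ k u ∉ p.2}.ncard

/-- The `n` for which `α n` and `β n` are both (nonnegative) integers. -/
def admissible (α β : ℝ) : Set ℕ :=
  {n | ∃ a b : ℕ, (a : ℝ) = α * n ∧ (b : ℝ) = β * n}

/-- `n → ∞` through the admissible values. -/
def admissibleAtTop (α β : ℝ) : Filter ℕ := atTop ⊓ 𝓟 (admissible α β)

/-- `r(d, ℓ)`: the number of proper edge colourings of a cycle of length `ℓ` with `d` colours. -/
def properColorings (d ℓ : ℕ) : ℕ :=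
  Fintype.card {c : Fin ℓ → Fin d // ∀ t, c t ≠ c (finRotate ℓ t)}

/-- `λ_ℓ = r(d, ℓ) / ℓ`. -/
def lam (d ℓ : ℕ) : ℝ := (properColorings d ℓ : ℝ) / ℓ

/-- `δ_ℓ = (αβ / ((1-α)(1-β)))^{ℓ/2}`, used for even `ℓ`. -/
def del (α β : ℝ) (ℓ : ℕ) : ℝ := (α * β / ((1 - α) * (1 - β))) ^ (ℓ / 2)

/-- The factor `x` per step of the cycle. -/
def stepWeight (α β : ℝ) : ℝ := (1 - α - β) / √((1 - α) * (1 - β))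

/-- The transfer matrix; the states are black in `V₁`, white in `V₁`, black in `V₂`, white in `V₂`. -/
def transferMatrix (α β : ℝ) : Matrix (Fin 4) (Fin 4) ℝ :=
  let y := α * (1 - α) / (1 - α - β) ^ 2
  let z := β * (1 - β) / (1 - α - β) ^ 2
  !![0, 0, 0, 1;
     0, 0, y, 1;
     0, 1, 0, 0;
     z, 1, 0, 0]

/-- The limiting ratio of the second moment to the square of the first moment. -/
def tau (d : ℕ) (α β : ℝ) : ℝ :=
  (1 - α - β + α * β) ^ d /
    ((1 - α - β + 2 * α * β) ^ (((d : ℝ) - 1) / 2) * (1 - α - β) ^ (((d : ℝ) - 1) / 2) *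
      √(1 - α - β + d * α * β) * √(1 - α - β - (d - 2) * α * β))

/-- `E[Y²] / E[Y]² → τ` as `n → ∞` through the admissible values. -/
def SecondMomentLimit (d : ℕ) (α β : ℝ) : Prop :=
  Tendsto (fun n : ℕ => (𝔼 σ : Matchings d n, (numIndep α β σ : ℝ) ^ 2) /
      (𝔼 σ : Matchings d n, (numIndep α β σ : ℝ)) ^ 2)
    (admissibleAtTop α β) (𝓝 (tau d α β))

/-! ### Small subgraph conditioning

For each `n`, `Ω n` is a finite probability space with the uniform distribution; `l` is the filter
along which `n → ∞`. Sequences are indexed from `0`. -/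

section Conditioning

variable {Ω : ℕ → Type} [∀ n, Fintype (Ω n)] [∀ n, Nonempty (Ω n)]

/-- For each `k`, the variables `X 0, …, X (k-1)` are asymptotically independent Poisson variables,
and their means converge to the means `μ i` of the limits. -/
def AsympIndepPoisson (l : Filter ℕ) (X : ∀ n, ℕ → Ω n → ℕ) (μ : ℕ → ℝ) : Prop :=
  (∀ i, Tendsto (fun n => 𝔼 ω : Ω n, (X n i ω : ℝ)) l (𝓝 (μ i))) ∧
  ∀ (k : ℕ) (a : Fin k → ℕ),
    Tendsto
      (fun n => (Nat.card {ω : Ω n // ∀ i : Fin k, X n i ω = a i} : ℝ) / Fintype.card (Ω n)) l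
      (𝓝 (∏ i : Fin k, Real.exp (-μ i) * μ i ^ a i / (a i).factorial))

/-- For all `m₀, …, m_{k-1}`,
`E(Y [X 0]_{m₀} ⋯ [X (k-1)]_{m_{k-1}}) / E Y → ∏ i < k, (μ i (1 + δ i)) ^ m_i`. -/
def JointFactorialMoments (l : Filter ℕ) (X : ∀ n, ℕ → Ω n → ℕ) (Y : ∀ n, Ω n → ℝ)
    (μ δ : ℕ → ℝ) : Prop :=
  ∀ (k : ℕ) (m : Fin k → ℕ),
    Tendsto
      (fun n => (𝔼 ω : Ω n, Y n ω * ∏ i : Fin k, ((X n i ω).descFactorial (m i) : ℝ)) /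
        (𝔼 ω : Ω n, Y n ω)) l
      (𝓝 (∏ i : Fin k, (μ i * (1 + δ i)) ^ m i))

/-- The hypotheses of the small subgraph conditioning theorem. -/
structure SmallSubgraphConditions (l : Filter ℕ) (X : ∀ n, ℕ → Ω n → ℕ) (Y : ∀ n, Ω n → ℝ)
    (μ δ : ℕ → ℝ) : Prop where
  mean_pos : ∀ i, 0 < μ i
  delta_gt : ∀ i, -1 < δ i
  nonneg : ∀ n ω, 0 ≤ Y n ω
  expect_pos : ∀ᶠ n in l, 0 < 𝔼 ω : Ω n, Y n ω
  poisson : AsympIndepPoisson l X μ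
  moments : JointFactorialMoments l X Y μ δ
  summable : Summable fun i => μ i * δ i ^ 2
  second_moment : ∀ ε > 0, ∀ᶠ n in l,
    (𝔼 ω : Ω n, Y n ω ^ 2) / (𝔼 ω : Ω n, Y n ω) ^ 2 ≤ Real.exp (∑' i, μ i * δ i ^ 2) + ε

end Conditioning

/-- `X_{2(i+1)}`: the even cycle counts, indexed from `0`. -/
def evenCycles (d n i : ℕ) (σ : Matchings d n) : ℕ := numCycles (2 * (i + 1)) σ

/-- `Y`, as a real random variable. -/
def indepCount (d : ℕ) (α β : ℝ) (n : ℕ) (σ : Matchings d n) : ℝ := numIndep α β σ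

/-- `λ_{2(i+1)}`. -/
def evenLam (d i : ℕ) : ℝ := lam d (2 * (i + 1))

/-- `δ_{2(i+1)}`. -/
def evenDel (α β : ℝ) (i : ℕ) : ℝ := del α β (2 * (i + 1))

end BipartiteHardCore

end

noncomputable section

namespace BipartiteHardCore

/-! ### Closed walks and traces -/

/-! Everything rests on one asymptotic computation of joint factorial moments, weighted by the
indicator that a fixed pair `S ∪ T` is independent and uniform over such pairs.

A product of falling factorials of cycle counts counts ordered families of distinct cycles. Giving
each cycle a base point in `V₁` and a direction makes it a `Tour`, at the cost of a factor equal to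
its length (`Tour.card_isFamily`). Condition on `S ∪ T` being independent. A switching argument
shows that exposing one more edge costs a factor close to its weight over `n`, the weight depending
only on which ends lie in `S` and `T` (`eventually_card_outcomes_insert`,
`eventually_card_outcomes`). Vertex-disjoint families therefore contribute a product of weights.
Distinct cycles that meet span more edges than vertices (`Tour.card_vertices_lt_card_edges`), so
overlapping families contribute `O(1/n)`.

The weight is `1 - γ h(u) g(w)`, where `h` and `g` are centred indicators. Summing over closed walks
gives the trace of a power of a matrix of rank at most two, namely `n ^ ℓ (1 + δ_ℓ)` for even length
`ℓ` (`sum_edgeWeight_walks`); the admissible choices of matchings contribute `r(d, ℓ)`. This yields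
(c) in `jointFactorialMoments`; the limit in (b) is a single first moment. Part (a) is the case `α =
β = 0`, where `Y = 1` and `δ = 0`, followed by the method of moments for Poisson limits.

For (d), `r(d, 2j) = (d-1)^{2j} + (d-1)` splits `∑ λ δ²` into two logarithmic series whose sum is
exactly `log τ` (`hasSum_evenLam_mul_evenDel_sq`). They converge because the assumed second moment
limit forces `1 - α - β - (d-2)αβ > 0`. -/

theorem matrix_pow_succ_apply_eq_sum {ι : Type*} [Fintype ι] [DecidableEq ι]
    (A : Matrix ι ι ℝ) (m : ℕ) (x y : ι) :
    (A ^ (m + 1)) x y =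
      ∑ f : Fin m → ι, ∏ t : Fin (m + 1),
        A ((Fin.cons x f : Fin (m + 1) → ι) t) ((Fin.snoc f y : Fin (m + 1) → ι) t) := by
  induction m generalizing x with
  | zero => simp [Fin.snoc]
  | succ m ih =>
    rw [pow_succ', Matrix.mul_apply, ← (Fin.consEquiv fun _ => ι).sum_comp,
      Fintype.sum_prod_type]
    refine Finset.sum_congr rfl fun z _ => ?_
    rw [ih, Finset.mul_sum]
    refine Finset.sum_congr rfl fun f _ => ?_
    rw [Fin.prod_univ_succ (n := m + 1)]
    simp [Fin.consEquiv, ← Fin.cons_snoc_eq_snoc_cons]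

/-- The trace of a power is the sum over closed walks. -/
theorem trace_pow_succ_eq_sum {ι : Type*} [Fintype ι] [DecidableEq ι]
    (A : Matrix ι ι ℝ) (m : ℕ) :
    (A ^ (m + 1)).trace = ∑ f : Fin (m + 1) → ι, ∏ t, A (f t) (f (t + 1)) := by
  rw [Matrix.trace, ← (Fin.consEquiv fun _ => ι).sum_comp, Fintype.sum_prod_type]
  refine Finset.sum_congr rfl fun x _ => ?_
  rw [Matrix.diag_apply, matrix_pow_succ_apply_eq_sum]
  refine Finset.sum_congr rfl fun f _ => Finset.prod_congr rfl fun t _ => ?_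
  congr 1
  simp only [Fin.consEquiv, Equiv.coe_fn_mk]
  induction t using Fin.lastCases with
  | last => simp
  | cast t => simp

/-- The all-ones matrix satisfies `U² = dU`, so `U - 1` has eigenvalues `d - 1` and `-1`. The
spectral decomposition is multiplied by `d` to avoid dividing by it. -/
theorem one_sub_matrix_pow (d ℓ : ℕ) :
    (d : ℝ) • ((Matrix.of fun _ _ => 1 : Matrix (Fin d) (Fin d) ℝ) - 1) ^ ℓ =
      ((d : ℝ) * (-1) ^ ℓ) • (1 : Matrix (Fin d) (Fin d) ℝ) +
        (((d : ℝ) - 1) ^ ℓ - (-1) ^ ℓ) • (Matrix.of fun _ _ => 1 : Matrix (Fin d) (Fin d) ℝ) := by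
  set U : Matrix (Fin d) (Fin d) ℝ := Matrix.of fun _ _ => 1 with hU
  have hUU : U * U = (d : ℝ) • U := by
    ext i j
    simp [hU, Matrix.mul_apply]
  induction ℓ with
  | zero => simp
  | succ ℓ ih =>
    rw [pow_succ, ← smul_mul_assoc, ih, mul_sub, add_mul, smul_mul_assoc, smul_mul_assoc, hUU]
    ext i j
    simp only [Matrix.sub_apply, Matrix.add_apply, Matrix.smul_apply, smul_eq_mul, mul_one,
      one_mul]
    ring

/-- Proper colourings of a cycle are closed walks in the complete graph on the colours, so a trace
counts them; the even length removes the sign of the eigenvalue `-1`. -/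
theorem properColorings_eq (d m : ℕ) (hd : 1 ≤ d) :
    (properColorings d (2 * (m + 1)) : ℝ) = ((d : ℝ) - 1) ^ (2 * (m + 1)) + ((d : ℝ) - 1) := by
  have hd0 : (d : ℝ) ≠ 0 := by positivity
  set A : Matrix (Fin d) (Fin d) ℝ := (Matrix.of fun _ _ => 1) - 1 with hA
  have hcard : (properColorings d (2 * (m + 1)) : ℝ) = (A ^ (2 * m + 1 + 1)).trace := by
    rw [trace_pow_succ_eq_sum, properColorings, Fintype.card_subtype, Finset.card_filter]
    push_cast
    refine Finset.sum_congr rfl fun c _ => ?_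
    have hprod : (∏ t : Fin (2 * m + 1 + 1), A (c t) (c (t + 1))) =
        ∏ t : Fin (2 * m + 1 + 1), if c t ≠ c (t + 1) then (1 : ℝ) else 0 := by
      refine Finset.prod_congr rfl fun t _ => ?_
      by_cases h : c t = c (t + 1)
      · simp [hA, h]
      · simp [hA, h]
    rw [hprod, Finset.prod_ite_zero]
    simp only [Finset.prod_const_one, Finset.mem_univ, forall_const]
    refine if_congr (forall_congr' fun t => ?_) rfl rfl
    rw [finRotate_apply]
  have hpow := congrArg Matrix.trace (one_sub_matrix_pow d (2 * m + 1 + 1))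
  rw [← hA, Matrix.trace_smul, ← hcard, Matrix.trace_add, Matrix.trace_smul, Matrix.trace_smul,
    Matrix.trace_one] at hpow
  have htr : (Matrix.of fun _ _ => 1 : Matrix (Fin d) (Fin d) ℝ).trace = d := by
    simp [Matrix.trace]
  have he : (-1 : ℝ) ^ (2 * m + 1 + 1) = 1 := by
    rw [show 2 * m + 1 + 1 = 2 * (m + 1) by ring, pow_mul]; simp
  rw [htr, he] at hpow
  simp only [smul_eq_mul, Fintype.card_fin] at hpow
  apply mul_left_cancel₀ hd0
  rw [hpow, show 2 * m + 1 + 1 = 2 * (m + 1) by ring]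
  ring

/-! ### The transfer matrix -/

/-- The quadratic relation has roots `1` and `q`, so both sides satisfy the same two-term
recurrence. The initial values `4` and `2(1 + q)` say that each root counts twice. -/
theorem trace_pow_of_sq_eq (M : Matrix (Fin 4) (Fin 4) ℝ) (q : ℝ)
    (hsq : M ^ 2 = (1 + q) • M - q • 1) (htr : M.trace = 2 * (1 + q)) (m : ℕ) :
    (M ^ m).trace = 2 * (1 + q ^ m) := by
  induction m using Nat.twoStepInduction with
  | zero => simp [Matrix.trace_one]; norm_num
  | one => simp [htr]
  | more m h0 h1 =>
    rw [pow_add, hsq, mul_sub, Matrix.trace_sub, mul_smul_comm, mul_smul_comm, ← pow_succ,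
      mul_one, Matrix.trace_smul, Matrix.trace_smul, h0, h1]
    simp only [smul_eq_mul]
    ring

/-- The transfer matrix exchanges the two sides, so its square is block diagonal. After scaling by
the squared step weight, each 2 × 2 block has trace `1 + q` and determinant `q = αβ / ((1-α)(1-β))`.
-/
theorem one_add_del_eq_trace (α β : ℝ) (hα : 0 ≤ α) (hβ : 0 ≤ β) (hαβ : α + β < 1) (m : ℕ) :
    1 + del α β (2 * m) = stepWeight α β ^ (2 * m) * (transferMatrix α β ^ (2 * m)).trace / 2 := by
  have h1 : 1 - α ≠ 0 := by linarith
  have h2 : 1 - β ≠ 0 := by linarith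
  have h3 : 1 - α - β ≠ 0 := by linarith
  have hP : 0 ≤ (1 - α) * (1 - β) := mul_nonneg (by linarith) (by linarith)
  have hx : stepWeight α β ^ 2 = (1 - α - β) ^ 2 / ((1 - α) * (1 - β)) := by
    rw [stepWeight, div_pow, Real.sq_sqrt hP]
  have hA : transferMatrix α β ^ 2 =
      !![β * (1 - β) / (1 - α - β) ^ 2, 1, 0, 0;
        β * (1 - β) / (1 - α - β) ^ 2, α * (1 - α) / (1 - α - β) ^ 2 + 1, 0, 0;
        0, 0, α * (1 - α) / (1 - α - β) ^ 2, 1;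
        0, 0, α * (1 - α) / (1 - α - β) ^ 2, β * (1 - β) / (1 - α - β) ^ 2 + 1] := by
    rw [pow_two]
    ext i j
    fin_cases i <;> fin_cases j <;>
      simp [transferMatrix, Matrix.mul_apply, Fin.sum_univ_four]
  have htr := trace_pow_of_sq_eq ((stepWeight α β ^ 2) • transferMatrix α β ^ 2)
    (α * β / ((1 - α) * (1 - β)))
    (by
      rw [hA, hx, pow_two]
      ext i j
      fin_cases i <;> fin_cases j <;>
        simp [Matrix.mul_apply, Fin.sum_univ_four] <;> field_simp <;> ring)
    (by
      rw [hA, hx]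
      simp [Matrix.trace, Fin.sum_univ_four]
      field_simp
      ring) m
  rw [smul_pow, Matrix.trace_smul, ← pow_mul, ← pow_mul, smul_eq_mul] at htr
  rw [htr, del, Nat.mul_div_cancel_left _ two_pos]
  ring

/-! ### The method of moments for Poisson limits -/

/-- Bonferroni's inequality: for `N = M + 1` the truncated alternating sum is `± M.choose r`, one of
the two terms of Pascal's rule for the bound. -/
theorem abs_alternating_sum_choose_sub_le (N r : ℕ) :
    |(if N = 0 then (1 : ℝ) else 0) - ∑ j ∈ Finset.range (r + 1), (-1 : ℝ) ^ j * N.choose j| ≤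
      N.choose (r + 1) := by
  rcases Nat.eq_zero_or_pos N with rfl | hN
  · have : ∑ j ∈ Finset.range (r + 1), (-1 : ℝ) ^ j * (Nat.choose 0 j : ℝ) = 1 := by
      rw [Finset.sum_range_succ']
      simp
    simp [this]
  · obtain ⟨M, rfl⟩ : ∃ M, N = M + 1 := ⟨N - 1, by omega⟩
    have h : ∑ j ∈ Finset.range (r + 1), (-1 : ℝ) ^ j * ((M + 1).choose j : ℝ) =
        (-1) ^ r * (M.choose r : ℝ) := by
      have := @Int.alternating_sum_range_choose_eq_choose M r
      exact_mod_cast this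
    rw [h, if_neg (by omega), zero_sub, abs_neg, abs_mul, abs_pow, abs_neg, abs_one, one_pow,
      one_mul, Nat.abs_cast, Nat.choose_succ_succ]
    push_cast
    linarith [(Nat.cast_nonneg (M.choose (r + 1)) : (0 : ℝ) ≤ _)]

theorem choose_mul_choose_sub_eq (X a j : ℕ) :
    (X.choose a : ℝ) * (X - a).choose j =
      (X.descFactorial (a + j) : ℝ) / (a.factorial * j.factorial) := by
  rw [eq_div_iff (by positivity)]
  have h1 := Nat.descFactorial_eq_factorial_mul_choose X a
  have h2 := Nat.descFactorial_eq_factorial_mul_choose (X - a) j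
  have h3 : X.descFactorial (a + j) = X.descFactorial a * (X - a).descFactorial j := by
    rw [mul_comm, ← Nat.descFactorial_mul_descFactorial (Nat.le_add_right a j),
      Nat.add_sub_cancel_left]
  rw [h3, h1, h2]
  push_cast
  ring

/-- Truncated inclusion-exclusion for the event `X = a`. -/
theorem abs_indicator_sub_le (X a r : ℕ) :
    |(if X = a then (1 : ℝ) else 0) - ∑ j ∈ Finset.range (r + 1),
        (-1 : ℝ) ^ j * ((X.descFactorial (a + j) : ℝ) / (a.factorial * j.factorial))| ≤
      (X.descFactorial (a + (r + 1)) : ℝ) / (a.factorial * (r + 1).factorial) := by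
  have h : ∀ j, (-1 : ℝ) ^ j * ((X.descFactorial (a + j) : ℝ) / (a.factorial * j.factorial)) =
      X.choose a * ((-1) ^ j * (X - a).choose j) := by
    intro j
    rw [← choose_mul_choose_sub_eq]
    ring
  -- The truncated difference `X - a` also vanishes when `X < a`, but then the binomial factor is
  -- zero.
  have h0 : (if X = a then (1 : ℝ) else 0) = X.choose a * (if X - a = 0 then 1 else 0) := by
    rcases lt_trichotomy X a with h | h | h
    · simp [h.ne, Nat.choose_eq_zero_of_lt h]
    · simp [h]
    · rw [if_neg h.ne', if_neg (by omega), mul_zero]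
  simp only [h]
  rw [h0, ← Finset.mul_sum, ← mul_sub, abs_mul, Nat.abs_cast, ← choose_mul_choose_sub_eq]
  exact mul_le_mul_of_nonneg_left (abs_alternating_sum_choose_sub_le _ _) (Nat.cast_nonneg _)

/-- If all weighted factorial moments converge to `c μ ^ m`, then the weighted probability of
`X = a` converges to the Poisson weight times `c`. -/
theorem tendsto_weighted_indicator {Ω : ℕ → Type} [∀ n, Fintype (Ω n)] (l : Filter ℕ)
    (X : ∀ n, Ω n → ℕ) (Y : ∀ n, Ω n → ℝ) (hY : ∀ n ω, 0 ≤ Y n ω) (c μ : ℝ)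
    (h : ∀ m : ℕ, Tendsto (fun n => ∑ ω, Y n ω * ((X n ω).descFactorial m : ℝ)) l
      (𝓝 (c * μ ^ m))) (a : ℕ) :
    Tendsto (fun n => ∑ ω, Y n ω * (if X n ω = a then 1 else 0)) l
      (𝓝 (c * (Real.exp (-μ) * μ ^ a / a.factorial))) := by
  set S : ℕ → ℝ := fun r => ∑ j ∈ Finset.range (r + 1),
    (-1 : ℝ) ^ j * (c * μ ^ (a + j) / (a.factorial * j.factorial)) with hS
  set R : ℕ → ℝ := fun r => c * μ ^ (a + (r + 1)) / (a.factorial * (r + 1).factorial) with hR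
  have hSlim : Tendsto S atTop (𝓝 (c * (Real.exp (-μ) * μ ^ a / a.factorial))) := by
    have h1 : HasSum (fun j : ℕ => (-μ) ^ j / (j.factorial : ℝ)) (Real.exp (-μ)) := by
      rw [Real.exp_eq_exp_ℝ]
      exact NormedSpace.expSeries_div_hasSum_exp (-μ)
    have h2 := ((h1.mul_left (c * μ ^ a / a.factorial)).tendsto_sum_nat).comp
      (tendsto_add_atTop_nat 1)
    refine (h2.congr fun r => ?_).trans (by rw [show c * μ ^ a / a.factorial * Real.exp (-μ) =
      c * (Real.exp (-μ) * μ ^ a / a.factorial) by ring])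
    refine Finset.sum_congr rfl fun j _ => ?_
    rw [neg_pow, pow_add]
    field_simp
  have hRlim : Tendsto R atTop (𝓝 0) := by
    have h1 := ((FloorSemiring.tendsto_pow_div_factorial_atTop μ).comp
      (tendsto_add_atTop_nat 1)).const_mul (c * μ ^ a / a.factorial)
    rw [mul_zero] at h1
    refine h1.congr fun r => ?_
    simp only [hR, Function.comp]
    rw [pow_add μ a]
    field_simp
  have hpart : ∀ r, Tendsto (fun n => ∑ j ∈ Finset.range (r + 1), (-1 : ℝ) ^ j *
      ((∑ ω, Y n ω * ((X n ω).descFactorial (a + j) : ℝ)) / (a.factorial * j.factorial))) l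
      (𝓝 (S r)) := fun r =>
    tendsto_finsetSum _ fun j _ => ((h (a + j)).div_const _).const_mul _
  have hrem : ∀ r, Tendsto (fun n => (∑ ω, Y n ω * ((X n ω).descFactorial (a + (r + 1)) : ℝ)) /
      (a.factorial * (r + 1).factorial)) l (𝓝 (R r)) := fun r => (h _).div_const _
  have hbound : ∀ r n, |∑ ω, Y n ω * (if X n ω = a then 1 else 0) -
      ∑ j ∈ Finset.range (r + 1), (-1 : ℝ) ^ j *
      ((∑ ω, Y n ω * ((X n ω).descFactorial (a + j) : ℝ)) / (a.factorial * j.factorial))| ≤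
      (∑ ω, Y n ω * ((X n ω).descFactorial (a + (r + 1)) : ℝ)) /
      (a.factorial * (r + 1).factorial) := by
    intro r n
    have e1 : ∑ j ∈ Finset.range (r + 1), (-1 : ℝ) ^ j *
        ((∑ ω, Y n ω * ((X n ω).descFactorial (a + j) : ℝ)) / (a.factorial * j.factorial)) =
        ∑ ω, Y n ω * ∑ j ∈ Finset.range (r + 1), (-1 : ℝ) ^ j *
          (((X n ω).descFactorial (a + j) : ℝ) / (a.factorial * j.factorial)) := by
      simp only [Finset.sum_div, Finset.mul_sum]
      rw [Finset.sum_comm]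
      refine Finset.sum_congr rfl fun ω _ => Finset.sum_congr rfl fun j _ => by ring
    rw [e1, ← Finset.sum_sub_distrib, Finset.sum_div]
    refine (Finset.abs_sum_le_sum_abs _ _).trans (Finset.sum_le_sum fun ω _ => ?_)
    rw [← mul_sub, abs_mul, abs_of_nonneg (hY n ω), mul_div_assoc]
    exact mul_le_mul_of_nonneg_left (abs_indicator_sub_le _ _ _) (hY n ω)
  rw [Metric.tendsto_nhds]
  intro ε hε
  -- The truncation level `r` is fixed before `n`, so that only finitely many moments have to be
  -- close to their limits.
  obtain ⟨r, hr1, hr2⟩ := ((Metric.tendsto_nhds.1 hSlim (ε / 4) (by positivity)).and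
    (Metric.tendsto_nhds.1 hRlim (ε / 4) (by positivity))).exists
  filter_upwards [Metric.tendsto_nhds.1 (hpart r) (ε / 4) (by positivity),
    Metric.tendsto_nhds.1 (hrem r) (ε / 4) (by positivity)] with n h1 h2
  have h3 := hbound r n
  rw [Real.dist_eq, abs_lt] at *
  rw [abs_le] at h3
  constructor <;> linarith [h1.1, h1.2, h2.1, h2.2, hr1.1, hr1.2, hr2.1, hr2.2, h3.1, h3.2]

/-- Joint version, one variable at a time. -/
theorem tendsto_weighted_joint_indicator {Ω : ℕ → Type} [∀ n, Fintype (Ω n)] (l : Filter ℕ)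
    (k : ℕ) (X : ∀ n, Fin k → Ω n → ℕ) (Y : ∀ n, Ω n → ℝ) (hY : ∀ n ω, 0 ≤ Y n ω) (c : ℝ)
    (μ : Fin k → ℝ)
    (h : ∀ m : Fin k → ℕ, Tendsto
      (fun n => ∑ ω, Y n ω * ∏ i, ((X n i ω).descFactorial (m i) : ℝ)) l
      (𝓝 (c * ∏ i, μ i ^ m i))) (a : Fin k → ℕ) :
    Tendsto (fun n => ∑ ω, Y n ω * ∏ i, (if X n i ω = a i then 1 else 0)) l
      (𝓝 (c * ∏ i, (Real.exp (-μ i) * μ i ^ a i / (a i).factorial))) := by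
  induction k generalizing Y c with
  | zero => simpa using h a
  | succ k ih =>
    -- The indicator of the first variable is absorbed into the weight and its Poisson probability
    -- into the constant; hence the general `Y` and `c`.
    have key := ih (fun n i => X n i.succ) (fun n ω => Y n ω * (if X n 0 ω = a 0 then 1 else 0))
      (fun n ω => mul_nonneg (hY n ω) (by split_ifs <;> norm_num))
      (c * (Real.exp (-μ 0) * μ 0 ^ a 0 / (a 0).factorial)) (fun i => μ i.succ) ?_
      (fun i => a i.succ)
    · simp only [Fin.prod_univ_succ]
      simpa only [mul_assoc] using key
    · intro m
      have := tendsto_weighted_indicator l (fun n => X n 0)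
        (fun n ω => Y n ω * ∏ i : Fin k, ((X n i.succ ω).descFactorial (m i) : ℝ))
        (fun n ω => mul_nonneg (hY n ω) (Finset.prod_nonneg fun _ _ => Nat.cast_nonneg _))
        (c * ∏ i : Fin k, μ i.succ ^ m i) (μ 0) (fun m0 => ?_) (a 0)
      · convert this using 2
        · exact Finset.sum_congr rfl fun ω _ => by ring
        · ring
      · convert h (Fin.cons m0 m) using 2
        · refine Finset.sum_congr rfl fun ω _ => ?_
          rw [Fin.prod_univ_succ]
          simp only [Fin.cons_zero, Fin.cons_succ]
          ring
        · rw [Fin.prod_univ_succ]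
          simp only [Fin.cons_zero, Fin.cons_succ]
          ring

theorem asympIndepPoisson_of_factorialMoments {Ω : ℕ → Type} [∀ n, Fintype (Ω n)]
    [∀ n, Nonempty (Ω n)] (l : Filter ℕ) (X : ∀ n, ℕ → Ω n → ℕ) (μ : ℕ → ℝ)
    (h : ∀ (k : ℕ) (m : Fin k → ℕ), Tendsto
      (fun n => 𝔼 ω : Ω n, ∏ i : Fin k, ((X n i ω).descFactorial (m i) : ℝ)) l
      (𝓝 (∏ i : Fin k, μ i ^ m i))) :
    AsympIndepPoisson l X μ := by
  constructor
  · intro i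
    have := h (i + 1) (Pi.single (Fin.last i) 1)
    rw [Fintype.prod_eq_single (Fin.last i) (by intro j hj; simp [Pi.single_eq_of_ne hj])] at this
    convert this using 2 with n
    · refine Finset.expect_congr rfl fun ω _ => ?_
      rw [Fintype.prod_eq_single (Fin.last i) (by intro j hj; simp [Pi.single_eq_of_ne hj])]
      simp
    · simp
  · intro k a
    have := tendsto_weighted_joint_indicator (Ω := Ω) l k (fun n i => X n i)
      (fun n _ => ((Fintype.card (Ω n) : ℝ))⁻¹) (fun n _ => by positivity) 1 (fun i => μ i)
      (fun m => ?_) a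
    · rw [one_mul] at this
      refine this.congr fun n => ?_
      rw [← Finset.mul_sum, inv_mul_eq_div]
      congr 1
      simp only [Finset.prod_ite_zero, Finset.prod_const_one, Finset.mem_univ, forall_const]
      rw [Finset.sum_boole, Nat.card_eq_fintype_card, Fintype.card_subtype]
    · rw [one_mul]
      refine (h k m).congr fun n => ?_
      rw [Fintype.expect_eq_sum_div_card, ← Finset.mul_sum, inv_mul_eq_div]

/-! ### Tours: cycles with a base point in `V₁` and a direction -/

/-- A (potential) disjoint union of directed closed walks. With a permutation `s` of `J` describing
the successor, the walk goes from `left t ∈ V₁` along the matching `fwd t` to `right t ∈ V₂` and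
along the matching `back t` to `left (s t)`. -/
@[ext]
structure Tour (d n : ℕ) (J : Type) where
  left : J → Fin n
  right : J → Fin n
  fwd : J → Fin d
  back : J → Fin d

namespace Tour

variable {d n : ℕ} {J : Type}

def equivProd (d n : ℕ) (J : Type) :
    Tour d n J ≃ ((J → Fin n) × (J → Fin n)) × (J → Fin d) × (J → Fin d) where
  toFun p := ((p.left, p.right), p.fwd, p.back)
  invFun q := ⟨q.1.1, q.1.2, q.2.1, q.2.2⟩

instance [Fintype J] [DecidableEq J] : Fintype (Tour d n J) :=
  Fintype.ofEquiv _ (equivProd d n J).symm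

instance : DecidableEq (Tour d n J) := Classical.decEq _

/-- The edges of a tour, as triples (matching, end in `V₁`, end in `V₂`). -/
def edge (s : Equiv.Perm J) (p : Tour d n J) (x : J × Bool) : Fin d × Fin n × Fin n :=
  if x.2 then (p.back x.1, p.left (s x.1), p.right x.1) else (p.fwd x.1, p.left x.1, p.right x.1)

@[simp] theorem edge_false (s : Equiv.Perm J) (p : Tour d n J) (t : J) :
    p.edge s (t, false) = (p.fwd t, p.left t, p.right t) := rfl

@[simp] theorem edge_true (s : Equiv.Perm J) (p : Tour d n J) (t : J) :
    p.edge s (t, true) = (p.back t, p.left (s t), p.right t) := rfl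

/-- Consecutive edges of the tour are in different matchings. -/
def Proper (s : Equiv.Perm J) (p : Tour d n J) : Prop :=
  ∀ t, p.fwd t ≠ p.back t ∧ p.back t ≠ p.fwd (s t)

/-- The underlying set of edges of the multigraph. -/
def edgeSet [Fintype J] (s : Equiv.Perm J) (p : Tour d n J) : Finset (Edge d n) :=
  Finset.univ.image fun x => ((p.edge s x).1, (p.edge s x).2.1)

/-- The tour traverses a cycle of the multigraph. -/
structure IsTour (σ : Matchings d n) (s : Equiv.Perm J) (p : Tour d n J) : Prop where
  left_inj : Function.Injective p.left
  right_inj : Function.Injective p.right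
  proper : p.Proper s
  present : ∀ x, σ (p.edge s x).1 (p.edge s x).2.1 = (p.edge s x).2.2

/-- Two tour edges at the same vertex of `V₁` are consecutive, and properness puts them in different
matchings. -/
theorem edge_key_injective {s : Equiv.Perm J} {p : Tour d n J} (hl : Function.Injective p.left)
    (hp : p.Proper s) : Function.Injective fun x => ((p.edge s x).1, (p.edge s x).2.1) := by
  rintro ⟨t, b⟩ ⟨t', b'⟩ h
  cases b <;> cases b' <;> simp only [edge_false, edge_true, Prod.mk.injEq] at h ⊢
  · exact ⟨hl h.2, trivial⟩
  · have := hl h.2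
    subst this
    exact absurd h.1.symm (hp t').2
  · have := hl h.2
    subst this
    exact absurd h.1 (hp t).2
  · exact ⟨s.injective (hl h.2), trivial⟩

theorem card_edgeSet [Fintype J] {s : Equiv.Perm J} {p : Tour d n J}
    (hl : Function.Injective p.left) (hp : p.Proper s) :
    (p.edgeSet s).card = 2 * Fintype.card J := by
  rw [edgeSet, Finset.card_image_of_injective _ (edge_key_injective hl hp), Finset.card_univ,
    Fintype.card_prod, Fintype.card_bool, mul_comm]

end Tour

/-- The successor on the positions of a cycle of length `2 (m + 1)`. -/
abbrev succPerm (m : ℕ) : Equiv.Perm (Fin (m + 1)) := Equiv.addRight 1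

/-- Positions on a cycle of length `2 (m + 1)`. -/
def interleave (m : ℕ) : Fin (m + 1) × Bool ≃ Fin (2 * (m + 1)) :=
  Equiv.ofBijective (fun x => ⟨2 * x.1 + x.2.toNat, by
      have := x.1.2; have := x.2.toNat_lt; omega⟩) <| by
    rw [Fintype.bijective_iff_injective_and_card]
    refine ⟨?_, by simp [mul_comm]⟩
    rintro ⟨t, b⟩ ⟨t', b'⟩ h
    simp only [Fin.mk.injEq] at h
    cases b <;> cases b' <;> simp only [Bool.toNat_true, Bool.toNat_false] at h <;>
      first | omega | (simp only [Prod.mk.injEq, and_true]; ext; omega)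

theorem val_finRotate {ℓ : ℕ} (t : Fin ℓ) : (finRotate ℓ t : ℕ) = (t + 1) % ℓ := by
  cases ℓ with
  | zero => exact t.elim0
  | succ ℓ => rw [finRotate_apply, Fin.val_add]; simp

theorem finRotate_interleave_false (m : ℕ) (t : Fin (m + 1)) :
    finRotate _ (interleave m (t, false)) = interleave m (t, true) := by
  ext
  rw [val_finRotate]
  simp only [interleave, Equiv.ofBijective_apply, Bool.toNat_true, Bool.toNat_false]
  exact Nat.mod_eq_of_lt (by omega)

theorem finRotate_interleave_true (m : ℕ) (t : Fin (m + 1)) :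
    finRotate _ (interleave m (t, true)) = interleave m (t + 1, false) := by
  ext
  rw [val_finRotate]
  simp only [interleave, Equiv.ofBijective_apply, Bool.toNat_true, Bool.toNat_false]
  rw [Fin.val_add_one]
  split_ifs with h
  · subst h
    simp [Nat.mul_add]
  · have : (t : ℕ) ≠ m := fun h' => h (Fin.ext h')
    rw [Nat.mod_eq_of_lt (by omega)]
    omega

theorem ends_eq_inl {d n : ℕ} {σ : Matchings d n} {e : Edge d n} {a : Fin n} {x : Fin n ⊕ Fin n}
    (h : ends σ e = s(Sum.inl a, x)) : e.2 = a ∧ x = Sum.inr (σ e.1 a) := by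
  rw [ends, Sym2.eq_iff] at h
  rcases h with ⟨h1, h2⟩ | ⟨h1, h2⟩
  · obtain rfl := Sum.inl.inj h1
    exact ⟨rfl, h2.symm⟩
  · exact absurd h2 (by simp)

theorem ends_eq_inr {d n : ℕ} {σ : Matchings d n} {e : Edge d n} {b : Fin n} {x : Fin n ⊕ Fin n}
    (h : ends σ e = s(Sum.inr b, x)) : x = Sum.inl e.2 ∧ σ e.1 e.2 = b := by
  rw [ends, Sym2.eq_iff] at h
  rcases h with ⟨h1, h2⟩ | ⟨h1, h2⟩
  · exact absurd h1 (by simp)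
  · exact ⟨h1.symm, Sum.inr.inj h2⟩

/-- Edges cross between the sides, so starting in `V₁` fixes the side of every later position, and
the matching of each edge supplies its colour. -/
theorem exists_isTour_of_inl {d n m : ℕ} {σ : Matchings d n}
    (v : Fin (2 * (m + 1)) → Fin n ⊕ Fin n) (e : Fin (2 * (m + 1)) → Edge d n)
    (hv : Function.Injective v) (he : Function.Injective e)
    (hve : ∀ t, ends σ (e t) = s(v t, v (finRotate _ t)))
    (h0 : ∃ a, v (interleave m (0, false)) = Sum.inl a) :
    ∃ p : Tour d n (Fin (m + 1)), p.IsTour σ (succPerm m) ∧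
      p.edgeSet (succPerm m) = Finset.univ.image e := by
  have hstep : ∀ t a, v (interleave m (t, false)) = Sum.inl a →
      (e (interleave m (t, false))).2 = a ∧
      v (interleave m (t, true)) = Sum.inr (σ (e (interleave m (t, false))).1 a) ∧
      v (interleave m (t + 1, false)) = Sum.inl (e (interleave m (t, true))).2 ∧
      σ (e (interleave m (t, true))).1 (e (interleave m (t, true))).2 =
        σ (e (interleave m (t, false))).1 a := by
    intro t a ha
    have h1 := hve (interleave m (t, false))
    rw [finRotate_interleave_false, ha] at h1
    obtain ⟨h1a, h1b⟩ := ends_eq_inl h1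
    have h2 := hve (interleave m (t, true))
    rw [finRotate_interleave_true, h1b] at h2
    obtain ⟨h2a, h2b⟩ := ends_eq_inr h2
    exact ⟨h1a, h1b, h2a, h2b⟩
  have hinl : ∀ t, ∃ a, v (interleave m (t, false)) = Sum.inl a := by
    intro t
    induction t using Fin.induction with
    | zero => exact h0
    | succ t ih =>
      obtain ⟨a, ha⟩ := ih
      have := (hstep _ a ha).2.2.1
      rw [Fin.coeSucc_eq_succ] at this
      exact ⟨_, this⟩
  choose u hu using hinl
  let p : Tour d n (Fin (m + 1)) :=
    { left := u
      right := fun t => σ (e (interleave m (t, false))).1 (u t)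
      fwd := fun t => (e (interleave m (t, false))).1
      back := fun t => (e (interleave m (t, true))).1 }
  have hnext : ∀ t, (e (interleave m (t, true))).2 = u (t + 1) := fun t =>
    Sum.inl.inj ((hstep t _ (hu t)).2.2.1.symm.trans (hu (t + 1)))
  have hkey : ∀ x, ((p.edge (succPerm m) x).1, (p.edge (succPerm m) x).2.1) =
      e (interleave m x) := by
    rintro ⟨t, b⟩
    cases b
    · exact Prod.ext rfl (hstep t _ (hu t)).1.symm
    · exact Prod.ext rfl (hnext t).symm
  have hright : ∀ t, v (interleave m (t, true)) = Sum.inr (p.right t) := fun t =>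
    (hstep t _ (hu t)).2.1
  have hpres : ∀ x, σ (p.edge (succPerm m) x).1 (p.edge (succPerm m) x).2.1 =
      (p.edge (succPerm m) x).2.2 := by
    rintro ⟨t, b⟩
    cases b
    · rfl
    · have := (hstep t _ (hu t)).2.2.2
      rw [hnext] at this
      exact this
  have hinj : Function.Injective fun x =>
      ((p.edge (succPerm m) x).1, (p.edge (succPerm m) x).2.1) := by
    simp only [hkey]
    exact he.comp (interleave m).injective
  refine ⟨p, ⟨?_, ?_, ?_, hpres⟩, ?_⟩
  · intro t t' h
    have := (interleave m).injective (hv ((hu t).trans ((congrArg Sum.inl h).trans (hu t').symm)))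
    exact congrArg Prod.fst this
  · intro t t' h
    have := (interleave m).injective
      (hv ((hright t).trans ((congrArg Sum.inr h).trans (hright t').symm)))
    exact congrArg Prod.fst this
  · intro t
    constructor
    · intro h
      have h1 := hpres (t, false)
      have h2 := hpres (t, true)
      -- Two edges of one matching with the same end in `V₂` coincide, against the injectivity of
      -- `e`. This also covers length two, where both left ends agree anyway.
      have h3 : p.left t = p.left (succPerm m t) := by
        apply (σ (p.fwd t)).injective
        simp only [Tour.edge_false, Tour.edge_true, ← h] at h1 h2
        rw [h1, h2]
      have := @hinj (t, false) (t, true) (by simp [h, h3])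
      simp at this
    · intro h
      have := @hinj (t, true) (succPerm m t, false) (by simp [h])
      simp at this
  · rw [Tour.edgeSet]
    simp only [hkey]
    rw [← Finset.image_univ_equiv (interleave m), Finset.image_image]
    rfl

theorem isCycle_iff_exists_isTour {d n m : ℕ} (σ : Matchings d n) (C : Finset (Edge d n)) :
    IsCycle σ (2 * (m + 1)) C ↔
      ∃ p : Tour d n (Fin (m + 1)), p.IsTour σ (succPerm m) ∧ p.edgeSet (succPerm m) = C := by
  constructor
  · rintro ⟨v, e, hv, he, hve, rfl⟩
    rcases h0 : v (interleave m (0, false)) with a | b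
    · exact exists_isTour_of_inl v e hv he hve ⟨a, h0⟩
    -- A cycle listed from `V₂` is shifted by one position so that it starts in `V₁`.
    · obtain ⟨p, hp, hpe⟩ := exists_isTour_of_inl (σ := σ) (v ∘ finRotate _) (e ∘ finRotate _)
        (hv.comp (finRotate _).injective) (he.comp (finRotate _).injective)
        (fun t => hve (finRotate _ t)) (by
          have := hve (interleave m (0, false))
          rw [h0] at this
          exact ⟨_, (ends_eq_inr this).1⟩)
      refine ⟨p, hp, hpe.trans ?_⟩
      rw [← Finset.image_image (f := finRotate (2 * (m + 1))) (g := e), Finset.image_univ_equiv]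
  · rintro ⟨p, hp, rfl⟩
    let v' : Fin (m + 1) × Bool → Fin n ⊕ Fin n := fun x =>
      if x.2 then Sum.inr (p.right x.1) else Sum.inl (p.left x.1)
    let e' : Fin (m + 1) × Bool → Edge d n := fun x =>
      ((p.edge (succPerm m) x).1, (p.edge (succPerm m) x).2.1)
    refine ⟨v' ∘ (interleave m).symm, e' ∘ (interleave m).symm, ?_, ?_, ?_, ?_⟩
    · refine Function.Injective.comp ?_ (interleave m).symm.injective
      rintro ⟨t, b⟩ ⟨t', b'⟩ h
      cases b <;> cases b' <;> simp [v'] at h ⊢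
      · exact hp.left_inj h
      · exact hp.right_inj h
    · exact (Tour.edge_key_injective hp.left_inj hp.proper).comp (interleave m).symm.injective
    · intro x
      obtain ⟨⟨t, b⟩, rfl⟩ := (interleave m).surjective x
      have := hp.present (t, b)
      cases b
      · rw [finRotate_interleave_false]
        simp only [Tour.edge_false] at this
        simp [v', e', ends, this]
      · rw [finRotate_interleave_true]
        simp only [Tour.edge_true, Equiv.coe_addRight] at this
        simp [v', e', ends, this]
    · rw [← Finset.image_image, Finset.image_univ_equiv]
      rfl

/-! ### The tours that traverse a given cycle. -/

namespace Tour

variable {d n m : ℕ} {σ : Matchings d n}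

theorem IsTour.eq_of_mem_of_right {J : Type} [Fintype J] {s : Equiv.Perm J} {p : Tour d n J}
    (hp : p.IsTour σ s) {e : Edge d n} (he : e ∈ p.edgeSet s) {t : J} (h : σ e.1 e.2 = p.right t) :
    e = (p.fwd t, p.left t) ∨ e = (p.back t, p.left (s t)) := by
  obtain ⟨⟨t', b⟩, -, rfl⟩ := Finset.mem_image.1 he
  have := (hp.present (t', b)).symm.trans h
  cases b <;> (obtain rfl := hp.right_inj this; simp)

theorem IsTour.eq_of_mem_of_left {J : Type} [Fintype J] {s : Equiv.Perm J} {p : Tour d n J}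
    (hp : p.IsTour σ s) {e : Edge d n} (he : e ∈ p.edgeSet s) {t : J} (h : e.2 = p.left (s t)) :
    e = (p.fwd (s t), p.left (s t)) ∨ e = (p.back t, p.left (s t)) := by
  obtain ⟨⟨t', b⟩, -, rfl⟩ := Finset.mem_image.1 he
  cases b
  · obtain rfl := hp.left_inj h
    simp
  · obtain rfl := s.injective (hp.left_inj h)
    simp

theorem mem_edgeSet {J : Type} [Fintype J] (s : Equiv.Perm J) (p : Tour d n J) (t : J) :
    (p.fwd t, p.left t) ∈ p.edgeSet s ∧ (p.back t, p.left (s t)) ∈ p.edgeSet s :=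
  ⟨Finset.mem_image.2 ⟨(t, false), Finset.mem_univ _, rfl⟩,
    Finset.mem_image.2 ⟨(t, true), Finset.mem_univ _, rfl⟩⟩

/-- A tour is determined by its set of edges and its first edge. -/
theorem IsTour.eq_of_edgeSet_eq {p q : Tour d n (Fin (m + 1))} (hp : p.IsTour σ (succPerm m))
    (hq : q.IsTour σ (succPerm m)) (he : q.edgeSet (succPerm m) = p.edgeSet (succPerm m))
    (h0 : (q.fwd 0, q.left 0) = (p.fwd 0, p.left 0)) : q = p := by
  have hstep : ∀ t, (q.fwd t, q.left t) = (p.fwd t, p.left t) →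
      q.right t = p.right t ∧ (q.back t, q.left (t + 1)) = (p.back t, p.left (t + 1)) ∧
        (q.fwd (t + 1), q.left (t + 1)) = (p.fwd (t + 1), p.left (t + 1)) := by
    intro t ht
    obtain ⟨hf, hl⟩ := Prod.mk.inj ht
    have h1 : q.right t = p.right t := by
      have e1 := hp.present (t, false)
      have e2 := hq.present (t, false)
      simp only [edge_false] at e1 e2
      rw [← e1, ← e2, hf, hl]
    have h2 : (q.back t, q.left (t + 1)) = (p.back t, p.left (t + 1)) := by
      -- Only two edges of the cycle meet this vertex; properness excludes the one just traversed.
      refine (hp.eq_of_mem_of_right (t := t) (he ▸ (mem_edgeSet _ q t).2) ?_).resolve_left ?_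
      · exact (hq.present (t, true)).trans h1
      · intro h
        exact (hq.proper t).1 (hf.trans (congrArg Prod.fst h).symm)
    refine ⟨h1, h2, ?_⟩
    obtain ⟨hb, hl'⟩ := Prod.mk.inj h2
    refine (hp.eq_of_mem_of_left (t := t) (he ▸ (mem_edgeSet (succPerm m) q (t + 1)).1)
      hl').resolve_right ?_
    intro h
    exact (hq.proper t).2 (hb.trans (congrArg Prod.fst h).symm)
  have hall : ∀ t, (q.fwd t, q.left t) = (p.fwd t, p.left t) := by
    intro t
    induction t using Fin.induction with
    | zero => exact h0
    | succ t ih =>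
      have := (hstep _ ih).2.2
      rwa [Fin.coeSucc_eq_succ] at this
  ext t : 2
  · exact (Prod.mk.inj (hall t)).2
  · exact (hstep t (hall t)).1
  · exact (Prod.mk.inj (hall t)).1
  · exact (Prod.mk.inj (hstep t (hall t)).2.1).1

/-- The tour started at position `r`. -/
def rotate (r : Fin (m + 1)) (p : Tour d n (Fin (m + 1))) : Tour d n (Fin (m + 1)) :=
  ⟨fun t => p.left (r + t), fun t => p.right (r + t), fun t => p.fwd (r + t),
    fun t => p.back (r + t)⟩

/-- The tour in the opposite direction, started with the edge back from position `r`. -/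
def reflect (r : Fin (m + 1)) (p : Tour d n (Fin (m + 1))) : Tour d n (Fin (m + 1)) :=
  ⟨fun t => p.left (r - t + 1), fun t => p.right (r - t), fun t => p.back (r - t),
    fun t => p.fwd (r - t)⟩

theorem edge_rotate (r : Fin (m + 1)) (p : Tour d n (Fin (m + 1))) (x : Fin (m + 1) × Bool) :
    (p.rotate r).edge (succPerm m) x = p.edge (succPerm m) (r + x.1, x.2) := by
  obtain ⟨t, b⟩ := x
  cases b <;> simp [rotate, add_assoc]

theorem edge_reflect (r : Fin (m + 1)) (p : Tour d n (Fin (m + 1))) (x : Fin (m + 1) × Bool) :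
    (p.reflect r).edge (succPerm m) x = p.edge (succPerm m) (r - x.1, !x.2) := by
  obtain ⟨t, b⟩ := x
  cases b
  · simp [reflect]
  · simp only [reflect, edge_true, Equiv.coe_addRight, Bool.not_true, edge_false, Prod.mk.injEq,
      true_and, and_true]
    congr 1
    abel

theorem IsTour.rotate {p : Tour d n (Fin (m + 1))} (hp : p.IsTour σ (succPerm m))
    (r : Fin (m + 1)) : (p.rotate r).IsTour σ (succPerm m) where
  left_inj := hp.left_inj.comp (add_right_injective r)
  right_inj := hp.right_inj.comp (add_right_injective r)
  proper t := by
    have := hp.proper (r + t)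
    simpa [Tour.rotate, add_assoc] using this
  present x := by
    rw [edge_rotate]
    exact hp.present _

theorem IsTour.reflect {p : Tour d n (Fin (m + 1))} (hp : p.IsTour σ (succPerm m))
    (r : Fin (m + 1)) : (p.reflect r).IsTour σ (succPerm m) where
  left_inj := hp.left_inj.comp ((add_left_injective 1).comp (sub_right_injective (b := r)))
  right_inj := hp.right_inj.comp (sub_right_injective (b := r))
  proper t := by
    refine ⟨(hp.proper (r - t)).1.symm, ?_⟩
    have := (hp.proper (r - (t + 1))).2
    simp only [Equiv.coe_addRight] at this
    rw [show r - (t + 1) + 1 = r - t by abel] at this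
    exact this.symm
  present x := by
    rw [edge_reflect]
    exact hp.present _

/-- Both edge sets have `2 (m + 1)` elements, so one inclusion suffices and `f` need not be shown
bijective. -/
theorem edgeSet_eq_of_subset {p q : Tour d n (Fin (m + 1))} (hp : p.IsTour σ (succPerm m))
    (hq : q.IsTour σ (succPerm m)) (f : Fin (m + 1) × Bool → Fin (m + 1) × Bool)
    (h : ∀ x, q.edge (succPerm m) x = p.edge (succPerm m) (f x)) :
    q.edgeSet (succPerm m) = p.edgeSet (succPerm m) := by
  refine Finset.eq_of_subset_of_card_le ?_ ?_
  · intro e he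
    obtain ⟨x, -, rfl⟩ := Finset.mem_image.1 he
    exact Finset.mem_image.2 ⟨f x, Finset.mem_univ _, by rw [h]⟩
  · rw [card_edgeSet hp.left_inj hp.proper, card_edgeSet hq.left_inj hq.proper]

/-- Every cycle of length `2 (m + 1)` is traversed by exactly `2 (m + 1)` tours. -/
theorem card_tours_of_edgeSet {p : Tour d n (Fin (m + 1))} (hp : p.IsTour σ (succPerm m)) :
    Nat.card {q : Tour d n (Fin (m + 1)) //
      q.IsTour σ (succPerm m) ∧ q.edgeSet (succPerm m) = p.edgeSet (succPerm m)} =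
      2 * (m + 1) := by
  let f : {q : Tour d n (Fin (m + 1)) //
      q.IsTour σ (succPerm m) ∧ q.edgeSet (succPerm m) = p.edgeSet (succPerm m)} →
      {e // e ∈ p.edgeSet (succPerm m)} :=
    fun q => ⟨(q.1.fwd 0, q.1.left 0), (Finset.ext_iff.1 q.2.2 _).1 (mem_edgeSet _ _ _).1⟩
  -- A tour corresponds to its first edge: forward edges are reached by rotating `p`, backward ones
  -- by reflecting it.
  have hf : Function.Bijective f := by
    constructor
    · intro q q' h
      exact Subtype.ext (q'.2.1.eq_of_edgeSet_eq q.2.1 (q.2.2.trans q'.2.2.symm)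
        (congrArg Subtype.val h))
    · rintro ⟨e, he⟩
      obtain ⟨⟨r, b⟩, -, rfl⟩ := Finset.mem_image.1 he
      cases b
      · refine ⟨⟨p.rotate r, hp.rotate r,
          edgeSet_eq_of_subset hp (hp.rotate r) _ (edge_rotate r p)⟩, Subtype.ext ?_⟩
        simp [f, Tour.rotate]
      · refine ⟨⟨p.reflect r, hp.reflect r,
          edgeSet_eq_of_subset hp (hp.reflect r) _ (edge_reflect r p)⟩, Subtype.ext ?_⟩
        simp [f, Tour.reflect]
  rw [Nat.card_eq_of_bijective f hf, Nat.card_eq_fintype_card, Fintype.card_coe,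
    card_edgeSet hp.left_inj hp.proper, Fintype.card_fin]

end Tour

/-! ### From tours to falling factorials. -/

theorem card_injective_lifts {T C : Type} [Finite T] [Finite C] (f : T → C) (L k : ℕ)
    (hL : ∀ c, Nat.card {p // f p = c} = L) :
    Nat.card {P : Fin k → T // Function.Injective (f ∘ P)} =
      L ^ k * (Nat.card C).descFactorial k := by
  classical
  have := Fintype.ofFinite T
  have := Fintype.ofFinite C
  let g : {P : Fin k → T // Function.Injective (f ∘ P)} → (Fin k ↪ C) := fun P => ⟨f ∘ P.1, P.2⟩
  have hfib : ∀ e : Fin k ↪ C, Nat.card {P // g P = e} = L ^ k := by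
    intro e
    let E : {P // g P = e} ≃ ∀ i, {p // f p = e i} :=
      { toFun := fun P i => ⟨P.1.1 i, congrArg (fun h : Fin k ↪ C => h i) P.2⟩
        invFun := fun Q => ⟨⟨fun i => (Q i).1, by
            have : f ∘ (fun i => (Q i).1) = e := funext fun i => (Q i).2
            rw [this]
            exact e.injective⟩, by
            ext i
            exact (Q i).2⟩
        left_inv := fun P => rfl
        right_inv := fun Q => rfl }
    rw [Nat.card_congr E, Nat.card_pi]
    simp only [hL, Finset.prod_const, Finset.card_univ, Fintype.card_fin]
  rw [Nat.card_congr (Equiv.sigmaFiberEquiv g).symm, Nat.card_sigma]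
  simp only [hfib, Finset.sum_const, Finset.card_univ, Fintype.card_embedding_eq, Fintype.card_fin,
    smul_eq_mul, Nat.card_eq_fintype_card, mul_comm]

/-- The falling factorial counts ordered tuples of distinct cycles, and each cycle has `2 (m + 1)`
independent choices of tour. -/
theorem card_injective_tours {d n m k : ℕ} (σ : Matchings d n) :
    Nat.card {P : Fin k → Tour d n (Fin (m + 1)) // (∀ i, (P i).IsTour σ (succPerm m)) ∧
      Function.Injective fun i => (P i).edgeSet (succPerm m)} =
      (2 * (m + 1)) ^ k * (numCycles (2 * (m + 1)) σ).descFactorial k := by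
  let f : {p : Tour d n (Fin (m + 1)) // p.IsTour σ (succPerm m)} →
      {C : Finset (Edge d n) | IsCycle σ (2 * (m + 1)) C} :=
    fun p => ⟨p.1.edgeSet (succPerm m), (isCycle_iff_exists_isTour σ _).2 ⟨p.1, p.2, rfl⟩⟩
  have key := card_injective_lifts f (2 * (m + 1)) k (by
    rintro ⟨C, hC⟩
    obtain ⟨p, hp, rfl⟩ := (isCycle_iff_exists_isTour σ _).1 hC
    refine (Nat.card_congr ?_).trans (Tour.card_tours_of_edgeSet hp)
    exact
      { toFun := fun q => ⟨q.1.1, q.1.2, congrArg Subtype.val q.2⟩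
        invFun := fun q => ⟨⟨q.1, q.2.1⟩, Subtype.ext q.2.2⟩
        left_inv := fun q => rfl
        right_inv := fun q => rfl })
  rw [numCycles, ← Nat.card_coe_set_eq, ← key]
  refine Nat.card_congr ?_
  exact
    { toFun := fun P => ⟨fun i => ⟨P.1 i, P.2.1 i⟩, fun i j h =>
        P.2.2 (congrArg Subtype.val h)⟩
      invFun := fun P => ⟨fun i => (P.1 i).1, fun i => (P.1 i).2, fun i j h =>
        P.2 (Subtype.ext h)⟩
      left_inv := fun P => rfl
      right_inv := fun P => rfl }

/-! ### Matchings that avoid an independent set and contain prescribed edges -/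

/-- `S ∪ T` is an independent set. -/
def Avoids {d n : ℕ} (S T : Finset (Fin n)) (σ : Matchings d n) : Prop :=
  ∀ k, ∀ u ∈ S, σ k u ∉ T

/-- All edges of `F`, given as triples (matching, end in `V₁`, end in `V₂`), are present. -/
def Contains {d n : ℕ} (σ : Matchings d n) (F : Finset (Fin d × Fin n × Fin n)) : Prop :=
  ∀ e ∈ F, σ e.1 e.2.1 = e.2.2

/-- The edges of `F` in each matching are pairwise disjoint. -/
def IsPartialMatching {d n : ℕ} (F : Finset (Fin d × Fin n × Fin n)) : Prop :=
  ∀ e ∈ F, ∀ e' ∈ F, e.1 = e'.1 → (e.2.1 = e'.2.1 ∨ e.2.2 = e'.2.2) → e = e'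

theorem Contains.isPartialMatching {d n : ℕ} {σ : Matchings d n}
    {F : Finset (Fin d × Fin n × Fin n)} (h : Contains σ F) : IsPartialMatching F := by
  rintro ⟨k, u, w⟩ he ⟨k', u', w'⟩ he' hk huw
  have h1 := h _ he
  have h2 := h _ he'
  simp only at hk huw h1 h2
  subst hk
  have hu : u = u' := huw.elim id fun hw => (σ k).injective (by rw [h1, h2, hw])
  subst hu
  rw [h1] at h2
  rw [h2]

open Classical in
/-- The outcomes in which `S ∪ T` is independent and the edges of `F` are present. -/
def outcomes {d n : ℕ} (S T : Finset (Fin n)) (F : Finset (Fin d × Fin n × Fin n)) :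
    Finset (Matchings d n) :=
  Finset.univ.filter fun σ => Avoids S T σ ∧ Contains σ F

theorem mem_outcomes {d n : ℕ} {S T : Finset (Fin n)} {F : Finset (Fin d × Fin n × Fin n)}
    {σ : Matchings d n} : σ ∈ outcomes S T F ↔ Avoids S T σ ∧ Contains σ F := by
  simp [outcomes]

/-! ### Switching one edge of a matching. -/

theorem swap_mem_iff {n : ℕ} {S : Finset (Fin n)} {u u' : Fin n} (h : u' ∈ S ↔ u ∈ S)
    (x : Fin n) : Equiv.swap u u' x ∈ S ↔ x ∈ S := by
  rcases eq_or_ne x u with rfl | h1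
  · rw [Equiv.swap_apply_left, h]
  · rcases eq_or_ne x u' with rfl | h2
    · rw [Equiv.swap_apply_right, h]
    · rw [Equiv.swap_apply_of_ne_of_ne h1 h2]

/-- Composing the `k`-th matching with the transpositions of `u, u'` and of `w, w'` is an injection.
It preserves independence, since `S` and `T` are invariant, and it moves no end of an edge of `F` in
that matching. -/
theorem card_outcomes_insert_le {d n : ℕ} {S T : Finset (Fin n)}
    {F : Finset (Fin d × Fin n × Fin n)} {k : Fin d} {u u' w w' : Fin n}
    (hu : u' ∈ S ↔ u ∈ S) (hw : w' ∈ T ↔ w ∈ T)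
    (hFu : ∀ e ∈ F, e.1 = k → e.2.1 ≠ u) (hFu' : ∀ e ∈ F, e.1 = k → e.2.1 ≠ u')
    (hFw : ∀ e ∈ F, e.1 = k → e.2.2 ≠ w) (hFw' : ∀ e ∈ F, e.1 = k → e.2.2 ≠ w') :
    (outcomes S T (insert (k, u, w) F)).card ≤ (outcomes S T (insert (k, u', w') F)).card := by
  let τ : Equiv.Perm (Fin n) → Equiv.Perm (Fin n) := fun π =>
    Equiv.swap w w' * π * Equiv.swap u u'
  have hτ : Function.Injective τ := fun π π' h => mul_left_cancel (mul_right_cancel h)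
  refine Finset.card_le_card_of_injOn (fun σ => Function.update σ k (τ (σ k))) ?_ ?_
  · intro σ hσ
    obtain ⟨hA, hC⟩ := mem_outcomes.1 hσ
    refine mem_outcomes.2 ⟨?_, ?_⟩
    · intro k' x hx
      rcases eq_or_ne k' k with rfl | hk
      · beta_reduce
        rw [Function.update_self]
        simp only [τ, Equiv.Perm.mul_apply]
        rw [swap_mem_iff hw]
        exact hA _ _ ((swap_mem_iff hu x).2 hx)
      · beta_reduce
        rw [Function.update_of_ne hk]
        exact hA _ _ hx
    · intro e he
      beta_reduce
      rcases Finset.mem_insert.1 he with rfl | he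
      · have := hC (k, u, w) (Finset.mem_insert_self _ _)
        simp only at this
        simp [τ, this]
      · have h1 := hC e (Finset.mem_insert_of_mem he)
        rcases eq_or_ne e.1 k with hk | hk
        · rw [hk, Function.update_self]
          simp only [τ, Equiv.Perm.mul_apply]
          rw [Equiv.swap_apply_of_ne_of_ne (hFu e he hk) (hFu' e he hk), ← hk, h1,
            Equiv.swap_apply_of_ne_of_ne (hFw e he hk) (hFw' e he hk)]
        · rw [Function.update_of_ne hk, h1]
  · intro σ _ σ' _ h
    funext k'
    have := congrFun h k'
    rcases eq_or_ne k' k with rfl | hk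
    · simp only [Function.update_self] at this
      exact hτ this
    · simpa only [Function.update_of_ne hk] using this

/-- The vertices with the same membership in `S` as `u` which are not `f e` for an edge `e` of `F`
in the matching `k`. -/
def freeLike {d n : ℕ} (S : Finset (Fin n)) (F : Finset (Fin d × Fin n × Fin n))
    (f : Fin n × Fin n → Fin n) (k : Fin d) (u : Fin n) : Finset (Fin n) :=
  Finset.univ.filter fun u' => (u' ∈ S ↔ u ∈ S) ∧ ∀ e ∈ F, e.1 = k → f e.2 ≠ u'

/-- By switching in both directions, all pairs of free vertices of the given types are equally
likely to be matched. Double counting outcomes with such a matched pair gives the identity. -/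
theorem card_freeLike_mul_card_outcomes {d n : ℕ} {S T : Finset (Fin n)}
    {F : Finset (Fin d × Fin n × Fin n)} {k : Fin d} {u w : Fin n}
    (hFu : ∀ e ∈ F, e.1 = k → e.2.1 ≠ u) (hFw : ∀ e ∈ F, e.1 = k → e.2.2 ≠ w) :
    (freeLike S F Prod.fst k u).card * (freeLike T F Prod.snd k w).card *
        (outcomes S T (insert (k, u, w) F)).card =
      ∑ σ ∈ outcomes S T F,
        ((freeLike S F Prod.fst k u).filter fun u' => σ k u' ∈ freeLike T F Prod.snd k w).card := by
  set P := freeLike S F Prod.fst k u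
  set Q := freeLike T F Prod.snd k w
  have h1 : ∀ u' ∈ P, ∀ w' ∈ Q, (outcomes S T (insert (k, u', w') F)).card =
      (outcomes S T (insert (k, u, w) F)).card := by
    intro u' hu' w' hw'
    obtain ⟨-, hu1, hu2⟩ := Finset.mem_filter.1 hu'
    obtain ⟨-, hw1, hw2⟩ := Finset.mem_filter.1 hw'
    exact le_antisymm (card_outcomes_insert_le hu1.symm hw1.symm hu2 hFu hw2 hFw)
      (card_outcomes_insert_le hu1 hw1 hFu hu2 hFw hw2)
  have h2 : ∀ u' w', (outcomes S T (insert (k, u', w') F)).card =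
      ∑ σ ∈ outcomes S T F, if σ k u' = w' then 1 else 0 := by
    intro u' w'
    rw [← Finset.card_filter]
    congr 1
    ext σ
    simp only [mem_outcomes, Finset.mem_filter, Contains, Finset.mem_insert, forall_eq_or_imp]
    tauto
  calc P.card * Q.card * (outcomes S T (insert (k, u, w) F)).card
      = ∑ u' ∈ P, ∑ w' ∈ Q, (outcomes S T (insert (k, u', w') F)).card := by
        rw [Finset.sum_congr rfl fun u' hu' => Finset.sum_congr rfl fun w' hw' => h1 u' hu' w' hw']
        simp [mul_assoc]
    _ = ∑ σ ∈ outcomes S T F, ∑ u' ∈ P, ∑ w' ∈ Q, if σ k u' = w' then 1 else 0 := by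
        simp only [h2]
        rw [Finset.sum_comm (s := outcomes S T F)]
        exact Finset.sum_congr rfl fun u' _ => Finset.sum_comm
    _ = _ := by
        refine Finset.sum_congr rfl fun σ _ => ?_
        rw [Finset.card_filter]
        refine Finset.sum_congr rfl fun u' _ => ?_
        simp

/-! ### Edge weights -/

/-- The proportion of `S` (for `true`) or of its complement. -/
def density (α : ℝ) (b : Bool) : ℝ := if b then α else 1 - α

/-- The limiting relative probability of an edge, given the membership of its ends in the
independent set. -/
def typeWeight (α β : ℝ) (b c : Bool) : ℝ :=
  1 - ((if b then 1 else 0) - α) * ((if c then 1 else 0) - β) / ((1 - α) * (1 - β))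

/-- The weight of the pair `(u, w)`. -/
def edgeWeight {n : ℕ} (α β : ℝ) (S T : Finset (Fin n)) (u w : Fin n) : ℝ :=
  typeWeight α β (decide (u ∈ S)) (decide (w ∈ T))

theorem abs_typeWeight_le {α β : ℝ} (hα : 0 ≤ α) (hβ : 0 ≤ β) (hαβ : α + β < 1) (b c : Bool) :
    |typeWeight α β b c| ≤ 1 + 1 / ((1 - α) * (1 - β)) := by
  have h1 : |(if b then (1 : ℝ) else 0) - α| ≤ 1 := by
    rw [abs_le]; cases b <;> simp <;> constructor <;> linarith
  have h2 : |(if c then (1 : ℝ) else 0) - β| ≤ 1 := by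
    rw [abs_le]; cases c <;> simp <;> constructor <;> linarith
  have hP : 0 < (1 - α) * (1 - β) := mul_pos (by linarith) (by linarith)
  rw [typeWeight]
  refine (abs_sub _ _).trans ?_
  rw [abs_one, abs_div, abs_mul, abs_of_pos hP]
  gcongr
  exact mul_le_one₀ h1 (abs_nonneg _) h2

theorem card_like {n : ℕ} {α : ℝ} {S : Finset (Fin n)} (hS : (S.card : ℝ) = α * n) (u : Fin n) :
    ((Finset.univ.filter fun u' => (u' ∈ S ↔ u ∈ S)).card : ℝ) =
      density α (decide (u ∈ S)) * n := by
  by_cases hu : u ∈ S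
  · simp [hu, density, hS]
  · have : (Finset.univ.filter fun u' => (u' ∈ S ↔ u ∈ S)) = Sᶜ := by
      ext; simp [hu]
    rw [this, Finset.card_compl, Fintype.card_fin, Nat.cast_sub (by
      simpa using S.card_le_univ), hS]
    simp [density, hu]
    ring

/-- Independence sends `S` into the complement of `T`, so the number of edges of each type does not
depend on `π`: it is `0`, `αn`, `βn` or `(1-α-β)n`. The weight is this number relative to the
product of densities. -/
theorem card_edges_like {n : ℕ} {α β : ℝ} (hα : 0 ≤ α) (hβ : 0 ≤ β) (hαβ : α + β < 1)
    {S T : Finset (Fin n)} (hS : (S.card : ℝ) = α * n) (hT : (T.card : ℝ) = β * n)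
    (π : Equiv.Perm (Fin n)) (hπ : ∀ u ∈ S, π u ∉ T) (u w : Fin n) :
    ((Finset.univ.filter fun u' => (u' ∈ S ↔ u ∈ S) ∧ (π u' ∈ T ↔ w ∈ T)).card : ℝ) =
      density α (decide (u ∈ S)) * density β (decide (w ∈ T)) * edgeWeight α β S T u w * n := by
  have h1 : 1 - α ≠ 0 := by linarith
  have h2 : 1 - β ≠ 0 := by linarith
  have hT' : ((Finset.univ.filter fun u' => π u' ∈ T).card : ℝ) = β * n := by
    rw [← hT]
    congr 1
    refine Finset.card_bij (fun x _ => π x) (by simp) (by simp) fun b hb => ?_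
    exact ⟨π.symm b, by simpa using hb, by simp⟩
  by_cases hu : u ∈ S <;> by_cases hw : w ∈ T
  · have : (Finset.univ.filter fun u' => (u' ∈ S ↔ u ∈ S) ∧ (π u' ∈ T ↔ w ∈ T)) = ∅ := by
      ext x; simpa [hu, hw] using hπ x
    rw [this]
    simp [edgeWeight, typeWeight, hu, hw]
    field_simp
    simp
  · have : (Finset.univ.filter fun u' => (u' ∈ S ↔ u ∈ S) ∧ (π u' ∈ T ↔ w ∈ T)) = S := by
      ext x; simpa [hu, hw] using hπ x
    rw [this, hS]
    simp only [edgeWeight, typeWeight, density, hu, hw, decide_true, decide_false, if_true,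
      Bool.false_eq_true, if_false]
    field_simp
    ring
  · have : (Finset.univ.filter fun u' => (u' ∈ S ↔ u ∈ S) ∧ (π u' ∈ T ↔ w ∈ T)) =
        Finset.univ.filter fun u' => π u' ∈ T := by
      ext x
      simp only [hu, hw, Finset.mem_filter, Finset.mem_univ, true_and, iff_false, iff_true,
        and_iff_right_iff_imp]
      exact fun h h' => hπ x h' h
    rw [this, hT']
    simp only [edgeWeight, typeWeight, density, hu, hw, decide_true, decide_false, if_true,
      Bool.false_eq_true, if_false]
    field_simp
    ring
  · have : (Finset.univ.filter fun u' => (u' ∈ S ↔ u ∈ S) ∧ (π u' ∈ T ↔ w ∈ T)) =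
        (S ∪ Finset.univ.filter fun u' => π u' ∈ T)ᶜ := by
      ext x; simp [hu, hw]
    have hdisj : Disjoint S (Finset.univ.filter fun u' => π u' ∈ T) := by
      rw [Finset.disjoint_left]
      intro x hx
      simpa using hπ x hx
    rw [this, Finset.card_compl, Nat.cast_sub (Finset.card_le_univ _),
      Finset.card_union_of_disjoint hdisj, Nat.cast_add, hS, hT', Fintype.card_fin]
    simp only [edgeWeight, typeWeight, density, hu, hw, decide_false,
      Bool.false_eq_true, if_false]
    field_simp
    ring

/-! ### Exposing the prescribed edges one at a time. -/

theorem card_freeLike_bounds {d n M : ℕ} {α : ℝ} {S : Finset (Fin n)}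
    (hS : (S.card : ℝ) = α * n) {F : Finset (Fin d × Fin n × Fin n)} (hF : F.card ≤ M)
    (f : Fin n × Fin n → Fin n) (k : Fin d) (u : Fin n) :
    density α (decide (u ∈ S)) * n - M ≤ (freeLike S F f k u).card ∧
      ((freeLike S F f k u).card : ℝ) ≤ density α (decide (u ∈ S)) * n := by
  rw [← card_like hS u]
  constructor
  · rw [sub_le_iff_le_add]
    have h : (Finset.univ.filter fun u' => (u' ∈ S ↔ u ∈ S)) ⊆
        freeLike S F f k u ∪ F.image fun e => f e.2 := by
      intro x hx
      simp only [Finset.mem_filter, Finset.mem_univ, true_and] at hx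
      by_cases h : ∀ e ∈ F, e.1 = k → f e.2 ≠ x
      · exact Finset.mem_union_left _ (Finset.mem_filter.2 ⟨Finset.mem_univ _, hx, h⟩)
      · push Not at h
        obtain ⟨e, he, -, rfl⟩ := h
        exact Finset.mem_union_right _ (Finset.mem_image_of_mem _ he)
    have := (Finset.card_le_card h).trans (Finset.card_union_le _ _)
    exact_mod_cast this.trans (Nat.add_le_add_left (Finset.card_image_le.trans hF) _)
  · exact_mod_cast Finset.card_le_card fun x hx => by
      simp only [freeLike, Finset.mem_filter, Finset.mem_univ, true_and] at hx ⊢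
      exact hx.1

/-- Each edge of `F` can spoil at most two edges of the matching, one at each of its ends; hence the
loss `2M`. -/
theorem card_free_edges_bounds {d n M : ℕ} {α β : ℝ} (hα : 0 ≤ α) (hβ : 0 ≤ β) (hαβ : α + β < 1)
    {S T : Finset (Fin n)} (hS : (S.card : ℝ) = α * n) (hT : (T.card : ℝ) = β * n)
    {F : Finset (Fin d × Fin n × Fin n)} (hF : F.card ≤ M) {σ : Matchings d n}
    (hσ : Avoids S T σ) (k : Fin d) (u w : Fin n) :
    density α (decide (u ∈ S)) * density β (decide (w ∈ T)) * edgeWeight α β S T u w * n - 2 * M ≤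
      (((freeLike S F Prod.fst k u).filter fun u' => σ k u' ∈ freeLike T F Prod.snd k w).card : ℝ) ∧
    (((freeLike S F Prod.fst k u).filter fun u' => σ k u' ∈ freeLike T F Prod.snd k w).card : ℝ) ≤
      density α (decide (u ∈ S)) * density β (decide (w ∈ T)) * edgeWeight α β S T u w * n := by
  rw [← card_edges_like hα hβ hαβ hS hT (σ k) (hσ k) u w]
  constructor
  · rw [sub_le_iff_le_add]
    have h : (Finset.univ.filter fun u' => (u' ∈ S ↔ u ∈ S) ∧ (σ k u' ∈ T ↔ w ∈ T)) ⊆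
        ((freeLike S F Prod.fst k u).filter fun u' => σ k u' ∈ freeLike T F Prod.snd k w) ∪
          ((F.image fun e => e.2.1) ∪ F.image fun e => (σ k).symm e.2.2) := by
      intro x hx
      simp only [Finset.mem_filter, Finset.mem_univ, true_and] at hx
      by_cases h : ∀ e ∈ F, e.1 = k → e.2.1 ≠ x
      · by_cases h' : ∀ e ∈ F, e.1 = k → e.2.2 ≠ σ k x
        · refine Finset.mem_union_left _ (Finset.mem_filter.2
            ⟨Finset.mem_filter.2 ⟨Finset.mem_univ _, hx.1, h⟩,
              Finset.mem_filter.2 ⟨Finset.mem_univ _, hx.2, h'⟩⟩)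
        · push Not at h'
          obtain ⟨e, he, -, h'⟩ := h'
          exact Finset.mem_union_right _ (Finset.mem_union_right _ (Finset.mem_image.2
            ⟨e, he, by rw [h', Equiv.symm_apply_apply]⟩))
      · push Not at h
        obtain ⟨e, he, -, rfl⟩ := h
        exact Finset.mem_union_right _ (Finset.mem_union_left _
          (Finset.mem_image_of_mem (fun e => e.2.1) he))
    have h1 := (Finset.card_le_card h).trans (Finset.card_union_le _ _)
    have h2 : ((F.image fun e => e.2.1) ∪ F.image fun e => (σ k).symm e.2.2).card ≤ 2 * M := by
      refine (Finset.card_union_le _ _).trans ?_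
      have h3 := (Finset.card_image_le (s := F) (f := fun e => e.2.1)).trans hF
      have h4 := (Finset.card_image_le (s := F) (f := fun e => (σ k).symm e.2.2)).trans hF
      omega
    exact_mod_cast h1.trans (Nat.add_le_add_left h2 _)
  · exact_mod_cast Finset.card_le_card fun x hx => by
      simp only [freeLike, Finset.mem_filter, Finset.mem_univ, true_and] at hx ⊢
      exact ⟨hx.1.1, hx.2.1⟩

/-- If `α = 0` then `S` is empty, so the type of density zero has no vertex. -/
theorem density_pos {n : ℕ} {α : ℝ} (hα : 0 ≤ α) (hα1 : α < 1) {S : Finset (Fin n)}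
    (hS : (S.card : ℝ) = α * n) (u : Fin n) : 0 < density α (decide (u ∈ S)) := by
  by_cases hu : u ∈ S
  · simp only [density, hu, decide_true, if_true]
    refine hα.lt_of_ne fun h => ?_
    rw [← h, zero_mul, Nat.cast_eq_zero, Finset.card_eq_zero] at hS
    simp [hS] at hu
  · simpa [density, hu] using hα1

theorem eventually_ratio_bounds (a b c ε : ℝ) (M : ℕ) (ha : 0 < a) (hb : 0 < b) (hε : 0 < ε) :
    ∀ᶠ n : ℕ in atTop, 0 < a * n - M ∧ 0 < b * n - M ∧
      a * b * c * n * n ≤ (c + ε) * ((a * n - M) * (b * n - M)) ∧ 2 * M ≤ ε * (a * b) * n := by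
  have hn : Tendsto (fun n : ℕ => (n : ℝ)) atTop atTop := tendsto_natCast_atTop_atTop
  have h1 : ∀ x : ℝ, 0 < x → ∀ᶠ n : ℕ in atTop, 0 < x * n - M := by
    intro x hx
    filter_upwards [(hn.const_mul_atTop hx).eventually_gt_atTop (M : ℝ)] with n h
    linarith
  have hlim : Tendsto (fun n : ℕ => (c + ε) * ((a - M / n) * (b - M / n))) atTop
      (𝓝 ((c + ε) * ((a - 0) * (b - 0)))) :=
    (((tendsto_const_div_atTop_nhds_zero_nat (M : ℝ)).const_sub a).mul
      ((tendsto_const_div_atTop_nhds_zero_nat (M : ℝ)).const_sub b)).const_mul _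
  have h3 : a * b * c < (c + ε) * ((a - 0) * (b - 0)) := by
    have : 0 < ε * (a * b) := by positivity
    nlinarith
  filter_upwards [h1 a ha, h1 b hb, hlim.eventually_const_lt h3, eventually_gt_atTop 0,
    (hn.const_mul_atTop (show 0 < ε * (a * b) by positivity)).eventually_ge_atTop (2 * M : ℝ)]
    with n h1 h2 h3 h0 h4
  refine ⟨h1, h2, ?_, h4⟩
  have hn0 : (0 : ℝ) < n := by exact_mod_cast h0
  have e : (c + ε) * ((a * n - M) * (b * n - M)) =
      (c + ε) * ((a - M / n) * (b - M / n)) * n * n := by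
    field_simp
  rw [e]
  gcongr

/-- Exposing one more edge multiplies the number of outcomes by about its weight over `n`. -/
theorem eventually_card_outcomes_insert {d : ℕ} {α β : ℝ} (hα : 0 ≤ α) (hβ : 0 ≤ β)
    (hαβ : α + β < 1) (M : ℕ) {ε : ℝ} (hε : 0 < ε) :
    ∀ᶠ n : ℕ in atTop, ∀ S T : Finset (Fin n), (S.card : ℝ) = α * n → (T.card : ℝ) = β * n →
      ∀ F : Finset (Fin d × Fin n × Fin n), F.card ≤ M → ∀ k u w,
        (∀ e ∈ F, e.1 = k → e.2.1 ≠ u) → (∀ e ∈ F, e.1 = k → e.2.2 ≠ w) →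
        |n * ((outcomes S T (insert (k, u, w) F)).card : ℝ) -
          edgeWeight α β S T u w * (outcomes S T F).card| ≤ ε * (outcomes S T F).card := by
  -- The estimates see the edge only through its four possible types, which makes them uniform in
  -- `S`, `T`, `u`, `w`.
  have hev : ∀ᶠ n : ℕ in atTop, ∀ b c : Bool, 0 < density α b → 0 < density β c →
      0 < density α b * n - M ∧ 0 < density β c * n - M ∧
      density α b * density β c * typeWeight α β b c * n * n ≤
        (typeWeight α β b c + ε) * ((density α b * n - M) * (density β c * n - M)) ∧
      2 * M ≤ ε * (density α b * density β c) * n := by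
    rw [eventually_all]
    intro b
    rw [eventually_all]
    intro c
    by_cases h : 0 < density α b ∧ 0 < density β c
    · filter_upwards [eventually_ratio_bounds (density α b) (density β c) (typeWeight α β b c) ε M
        h.1 h.2 hε] with n hn _ _ using hn
    · exact Eventually.of_forall fun n h1 h2 => absurd ⟨h1, h2⟩ h
  filter_upwards [hev, eventually_gt_atTop 0] with n hn hn0 S T hS hT F hF k u w hFu hFw
  have hn0 : (0 : ℝ) < n := by exact_mod_cast hn0
  have ha := density_pos hα (by linarith) hS u
  have hb := density_pos hβ (by linarith) hT w
  obtain ⟨h1, h2, h3, h4⟩ := hn _ _ ha hb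
  change _ * edgeWeight α β S T u w * n * n ≤ (edgeWeight α β S T u w + ε) * _ at h3
  set a := density α (decide (u ∈ S))
  set b := density β (decide (w ∈ T))
  set c := edgeWeight α β S T u w
  set W : ℝ := ((outcomes S T F).card : ℝ)
  set W' : ℝ := ((outcomes S T (insert (k, u, w) F)).card : ℝ)
  have hW : 0 ≤ W := Nat.cast_nonneg _
  have hW' : 0 ≤ W' := Nat.cast_nonneg _
  obtain ⟨hP1, hP2⟩ := card_freeLike_bounds hS hF Prod.fst k u
  obtain ⟨hQ1, hQ2⟩ := card_freeLike_bounds hT hF Prod.snd k w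
  have hsum : ((freeLike S F Prod.fst k u).card : ℝ) * (freeLike T F Prod.snd k w).card * W' =
      ∑ σ ∈ outcomes S T F, (((freeLike S F Prod.fst k u).filter fun u' =>
        σ k u' ∈ freeLike T F Prod.snd k w).card : ℝ) := by
    simp only [W']
    exact_mod_cast card_freeLike_mul_card_outcomes hFu hFw
  set p : ℝ := ((freeLike S F Prod.fst k u).card : ℝ)
  set q : ℝ := ((freeLike T F Prod.snd k w).card : ℝ)
  have hup : p * q * W' ≤ a * b * c * n * W := by
    rw [hsum]
    calc _ ≤ ∑ σ ∈ outcomes S T F, a * b * c * n := Finset.sum_le_sum fun σ hσ =>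
          (card_free_edges_bounds hα hβ hαβ hS hT hF (mem_outcomes.1 hσ).1 k u w).2
      _ = _ := by rw [Finset.sum_const, nsmul_eq_mul, mul_comm]
  have hlow : (a * b * c * n - 2 * M) * W ≤ p * q * W' := by
    rw [hsum]
    calc _ = ∑ σ ∈ outcomes S T F, (a * b * c * n - 2 * M) := by
          rw [Finset.sum_const, nsmul_eq_mul, mul_comm]
      _ ≤ _ := Finset.sum_le_sum fun σ hσ =>
          (card_free_edges_bounds hα hβ hαβ hS hT hF (mem_outcomes.1 hσ).1 k u w).1
  have hpq1 : (a * n - M) * (b * n - M) * W' ≤ p * q * W' := by gcongr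
  have hpq2 : p * q * W' ≤ a * n * (b * n) * W' := by gcongr
  rw [abs_le]
  constructor
  · have hab : 0 < a * b * n := by positivity
    refine le_of_mul_le_mul_left ?_ hab
    have h5 := mul_le_mul_of_nonneg_right h4 hW
    nlinarith
  · have hpos : 0 < (a * n - M) * (b * n - M) := mul_pos h1 h2
    refine le_of_mul_le_mul_left ?_ hpos
    have h5 := mul_le_mul_of_nonneg_right h3 hW
    have h6 := mul_le_mul_of_nonneg_left (hpq1.trans hup) hn0.le
    nlinarith

/-- Uniformly in the independent set and in a bounded number of prescribed edges, the probability of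
these edges is asymptotic to the product of their weights over `n`. -/
theorem eventually_card_outcomes {d : ℕ} {α β : ℝ} (hα : 0 ≤ α) (hβ : 0 ≤ β)
    (hαβ : α + β < 1) (M : ℕ) {ε : ℝ} (hε : 0 < ε) :
    ∀ᶠ n : ℕ in atTop, ∀ S T : Finset (Fin n), (S.card : ℝ) = α * n → (T.card : ℝ) = β * n →
      ∀ F : Finset (Fin d × Fin n × Fin n), F.card = M → IsPartialMatching F →
        |(n : ℝ) ^ M * ((outcomes S T F).card : ℝ) -
          (∏ e ∈ F, edgeWeight α β S T e.2.1 e.2.2) *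
            (outcomes S T (∅ : Finset (Fin d × Fin n × Fin n))).card| ≤
          ε * (outcomes S T (∅ : Finset (Fin d × Fin n × Fin n))).card := by
  induction M generalizing ε with
  | zero =>
    refine Eventually.of_forall fun n S T _ _ F hF _ => ?_
    rw [Finset.card_eq_zero] at hF
    subst hF
    simp only [pow_zero, one_mul, Finset.prod_empty, sub_self, abs_zero]
    positivity
  | succ M ih =>
    set B : ℝ := 1 + 1 / ((1 - α) * (1 - β)) with hB
    have hP : 0 < (1 - α) * (1 - β) := mul_pos (by linarith) (by linarith)
    have hB0 : 0 < B := by positivity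
    -- The cap `1` gives the a priori bound `n ^ M * W ≤ (B ^ M + 1) * W₀`. With `ε₂`, the error of
    -- the new edge and that of the earlier ones are each at most `ε / 2` times `W₀`.
    set ε₁ : ℝ := min 1 (ε / (2 * B)) with hε₁
    have hε₁0 : 0 < ε₁ := lt_min one_pos (by positivity)
    set ε₂ : ℝ := ε / (2 * (B ^ M + 1)) with hε₂
    have hε₂0 : 0 < ε₂ := by positivity
    filter_upwards [ih hε₁0, eventually_card_outcomes_insert (d := d) hα hβ hαβ M hε₂0]
      with n h1 h2 S T hS hT F hF hPM
    obtain ⟨⟨k, u, w⟩, F', hnot, rfl, hF'⟩ := Finset.card_eq_succ.1 hF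
    have hPM' : IsPartialMatching F' := fun e he e' he' =>
      hPM e (Finset.mem_insert_of_mem he) e' (Finset.mem_insert_of_mem he')
    have key1 := h1 S T hS hT F' hF' hPM'
    have key2 := h2 S T hS hT F' hF'.le k u w
      (fun e he hk hu => hnot (hPM e (Finset.mem_insert_of_mem he) _ (Finset.mem_insert_self _ _)
        hk (Or.inl hu) ▸ he))
      (fun e he hk hw => hnot (hPM e (Finset.mem_insert_of_mem he) _ (Finset.mem_insert_self _ _)
        hk (Or.inr hw) ▸ he))
    rw [Finset.prod_insert hnot]
    set c := edgeWeight α β S T u w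
    set W : ℝ := ((outcomes S T F').card : ℝ)
    set W' : ℝ := ((outcomes S T (insert (k, u, w) F')).card : ℝ)
    set W₀ : ℝ := ((outcomes S T (∅ : Finset (Fin d × Fin n × Fin n))).card : ℝ)
    set π := ∏ e ∈ F', edgeWeight α β S T e.2.1 e.2.2 with hπ
    have hW₀ : 0 ≤ W₀ := Nat.cast_nonneg _
    have hc : |c| ≤ B := abs_typeWeight_le hα hβ hαβ _ _
    have hπB : |π| ≤ B ^ M := by
      rw [hπ, Finset.abs_prod, ← hF']
      refine (Finset.prod_le_prod (fun _ _ => abs_nonneg _)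
        fun e _ => abs_typeWeight_le hα hβ hαβ _ _).trans ?_
      rw [Finset.prod_const]
    have hnW : (n : ℝ) ^ M * W ≤ (B ^ M + 1) * W₀ := by
      have h3 := (abs_le.1 key1).2
      have h4 : π * W₀ ≤ B ^ M * W₀ := by
        gcongr
        exact (le_abs_self _).trans hπB
      have h5 : ε₁ * W₀ ≤ 1 * W₀ := by
        gcongr
        exact min_le_left _ _
      linarith
    have e : (n : ℝ) ^ (M + 1) * W' - c * π * W₀ =
        (n : ℝ) ^ M * (n * W' - c * W) + c * ((n : ℝ) ^ M * W - π * W₀) := by ring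
    rw [e]
    refine (abs_add_le _ _).trans ?_
    rw [abs_mul, abs_mul, abs_of_nonneg (show (0 : ℝ) ≤ (n : ℝ) ^ M by positivity)]
    calc (n : ℝ) ^ M * |n * W' - c * W| + |c| * |(n : ℝ) ^ M * W - π * W₀|
        ≤ (n : ℝ) ^ M * (ε₂ * W) + B * (ε₁ * W₀) := by gcongr
      _ = ε₂ * ((n : ℝ) ^ M * W) + B * ε₁ * W₀ := by ring
      _ ≤ ε₂ * ((B ^ M + 1) * W₀) + B * (ε / (2 * B)) * W₀ := by
          gcongr
          exact min_le_right _ _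
      _ = ε * W₀ := by
          rw [hε₂]
          field_simp
          ring

/-! ### Sums over placements of vertices -/

/-- Maps into `Fin n`, weighted by `n` to the minus the size of the image, have bounded total
weight. -/
theorem sum_inv_pow_card_image_le {J : Type} [Fintype J] [DecidableEq J] (n : ℕ) (hn : 0 < n) :
    ∑ f : J → Fin n, ((n : ℝ) ^ (Finset.univ.image f).card)⁻¹ ≤
      (Fintype.card J : ℝ) ^ Fintype.card J := by
  have hn0 : (0 : ℝ) < n := by exact_mod_cast hn
  -- Choosing a representative in each fibre of `f` gives `ρ`. There are at most `|J| ^ |J|` maps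
  -- `ρ`, and for each one `f` is determined by its values on the image of `ρ`.
  have hrep : ∀ f : J → Fin n, ∃ ρ : J → J, (∀ t, f (ρ t) = f t) ∧
      (Finset.univ.image ρ).card ≤ (Finset.univ.image f).card := by
    intro f
    have hg : ∀ y : {y // y ∈ Finset.univ.image f}, ∃ t, f t = y := by
      rintro ⟨y, hy⟩
      obtain ⟨t, -, ht⟩ := Finset.mem_image.1 hy
      exact ⟨t, ht⟩
    choose g hg using hg
    refine ⟨fun t => g ⟨f t, Finset.mem_image_of_mem _ (Finset.mem_univ t)⟩, fun t => hg _, ?_⟩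
    have hsub : (Finset.univ.image fun t =>
        g ⟨f t, Finset.mem_image_of_mem _ (Finset.mem_univ t)⟩) ⊆ Finset.univ.image g := by
      intro x hx
      obtain ⟨t, -, rfl⟩ := Finset.mem_image.1 hx
      exact Finset.mem_image_of_mem _ (Finset.mem_univ _)
    refine (Finset.card_le_card hsub).trans (Finset.card_image_le.trans ?_)
    rw [Finset.card_univ, Fintype.card_coe]
  choose ρ hρ1 hρ2 using hrep
  have hfib : ∀ r : J → J, ∑ f ∈ Finset.univ.filter (fun f : J → Fin n => ρ f = r),
      ((n : ℝ) ^ (Finset.univ.image f).card)⁻¹ ≤ 1 := by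
    intro r
    have hcard : (Finset.univ.filter fun f : J → Fin n => ρ f = r).card ≤
        n ^ (Finset.univ.image r).card := by
      have : Fintype.card (↥(Finset.univ.image r) → Fin n) =
          n ^ (Finset.univ.image r).card := by
        rw [Fintype.card_fun, Fintype.card_coe, Fintype.card_fin]
      rw [← this, ← Finset.card_univ]
      refine Finset.card_le_card_of_injOn (fun f x => f x.1)
        (fun _ _ => Finset.mem_coe.2 (Finset.mem_univ _)) ?_
      intro f hf f' hf' h
      simp only [Finset.coe_filter, Finset.mem_univ, true_and, Set.mem_ofPred_eq] at hf hf'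
      funext t
      have := congrFun h ⟨r t, Finset.mem_image_of_mem _ (Finset.mem_univ t)⟩
      simp only at this
      rw [← hρ1 f t, ← hρ1 f' t, hf, hf', this]
    calc _ ≤ ∑ f ∈ Finset.univ.filter (fun f : J → Fin n => ρ f = r),
          ((n : ℝ) ^ (Finset.univ.image r).card)⁻¹ := by
          refine Finset.sum_le_sum fun f hf => ?_
          have hf' := (Finset.mem_filter.1 hf).2
          have := hρ2 f
          rw [hf'] at this
          gcongr
          exact_mod_cast hn
      _ ≤ 1 := by
          rw [Finset.sum_const, nsmul_eq_mul, ← div_eq_mul_inv, div_le_one (by positivity)]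
          exact_mod_cast hcard
  rw [← Finset.sum_fiberwise (s := Finset.univ) (g := ρ)]
  refine (Finset.sum_le_sum fun r _ => hfib r).trans ?_
  simp

/-- The sum is the trace of a power of the all-ones matrix plus `a h hᵀ`. Since `h` is orthogonal to
constants, the contributing eigenvalues are `n` and `abn`. -/
theorem sum_one_add_mul_kernel (n m : ℕ) (a b : ℝ) (h : Fin n → ℝ) (h0 : ∑ u, h u = 0)
    (h2 : ∑ u, h u ^ 2 = b * n) :
    ∑ f : Fin (m + 1) → Fin n, ∏ t, (1 + a * h (f t) * h (f (t + 1))) =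
      (n : ℝ) ^ (m + 1) * (1 + (a * b) ^ (m + 1)) := by
  let A : Matrix (Fin n) (Fin n) ℝ := Matrix.of fun u u' => 1 + a * h u * h u'
  have hpow : ∀ m, A ^ (m + 1) = Matrix.of fun u u' =>
      (n : ℝ) ^ m + a * (a * b * n) ^ m * h u * h u' := by
    intro m
    induction m with
    | zero => ext; simp [A]
    | succ m ih =>
      rw [pow_succ, ih]
      ext u u'
      simp only [Matrix.mul_apply, Matrix.of_apply, A]
      have e : ∀ x, ((n : ℝ) ^ m + a * (a * b * n) ^ m * h u * h x) * (1 + a * h x * h u') =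
          (n : ℝ) ^ m + (a * n ^ m * h u' + a * (a * b * n) ^ m * h u) * h x +
            a * (a * b * n) ^ m * a * h u * h u' * h x ^ 2 := by intro x; ring
      simp only [e, Finset.sum_add_distrib, ← Finset.mul_sum, h0, h2]
      simp
      ring
  have := trace_pow_succ_eq_sum A m
  rw [hpow] at this
  simp only [A, Matrix.of_apply] at this
  rw [← this, Matrix.trace]
  simp only [Matrix.diag_apply, Matrix.of_apply]
  have e : ∀ u, (n : ℝ) ^ m + a * (a * b * n) ^ m * h u * h u =
      (n : ℝ) ^ m + a * (a * b * n) ^ m * h u ^ 2 := by intro u; ring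
  simp only [e, Finset.sum_add_distrib, ← Finset.mul_sum, h2]
  simp
  ring

theorem sum_indicator_sub {n : ℕ} {α : ℝ} {S : Finset (Fin n)} (hS : (S.card : ℝ) = α * n) :
    ∑ u, ((if u ∈ S then (1 : ℝ) else 0) - α) = 0 ∧
      ∑ u, ((if u ∈ S then (1 : ℝ) else 0) - α) ^ 2 = α * (1 - α) * n := by
  constructor
  · simp [Finset.sum_sub_distrib, hS]
    ring
  · have : ∀ u, ((if u ∈ S then (1 : ℝ) else 0) - α) ^ 2 =
        (1 - 2 * α) * (if u ∈ S then (1 : ℝ) else 0) + α ^ 2 := by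
      intro u; split_ifs <;> ring
    simp only [this, Finset.sum_add_distrib, ← Finset.mul_sum]
    simp [hS]
    ring

theorem edgeWeight_eq {n : ℕ} (α β : ℝ) (S T : Finset (Fin n)) (u w : Fin n) :
    edgeWeight α β S T u w = 1 - ((if u ∈ S then 1 else 0) - α) * ((if w ∈ T then 1 else 0) - β) /
      ((1 - α) * (1 - β)) := by
  simp [edgeWeight, typeWeight]

/-- The total weight of the closed walks of length `2 (m + 1)` with given colours. -/
theorem sum_edgeWeight_walks {n : ℕ} (m : ℕ) {α β : ℝ} (hα : 0 ≤ α) (hβ : 0 ≤ β)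
    (hαβ : α + β < 1) {S T : Finset (Fin n)} (hS : (S.card : ℝ) = α * n)
    (hT : (T.card : ℝ) = β * n) :
    ∑ q : (Fin (m + 1) → Fin n) × (Fin (m + 1) → Fin n),
      ∏ t, (edgeWeight α β S T (q.1 t) (q.2 t) * edgeWeight α β S T (q.1 (t + 1)) (q.2 t)) =
      (n : ℝ) ^ (2 * (m + 1)) * (1 + del α β (2 * (m + 1))) := by
  have h1 : 1 - α ≠ 0 := by linarith
  have h2 : 1 - β ≠ 0 := by linarith
  obtain ⟨hS0, hS2⟩ := sum_indicator_sub hS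
  obtain ⟨hT0, hT2⟩ := sum_indicator_sub hT
  set h : Fin n → ℝ := fun u => (if u ∈ S then (1 : ℝ) else 0) - α with hh
  set g : Fin n → ℝ := fun u => (if u ∈ T then (1 : ℝ) else 0) - β with hg
  set γ : ℝ := 1 / ((1 - α) * (1 - β)) with hγ
  have hw : ∀ u w, edgeWeight α β S T u w = 1 - γ * h u * g w := by
    intro u w
    rw [edgeWeight_eq, hγ]
    ring
  -- Summing out `V₂` first kills the terms linear in the centred `g` and leaves a kernel on `V₁` to
  -- which `sum_one_add_mul_kernel` applies.
  have hin : ∀ u u', ∑ w, edgeWeight α β S T u w * edgeWeight α β S T u' w =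
      n * (1 + γ ^ 2 * (β * (1 - β)) * h u * h u') := by
    intro u u'
    have e : ∀ w, edgeWeight α β S T u w * edgeWeight α β S T u' w =
        1 - γ * (h u + h u') * g w + γ ^ 2 * h u * h u' * g w ^ 2 := by
      intro w; rw [hw, hw]; ring
    simp only [e, Finset.sum_add_distrib, Finset.sum_sub_distrib, ← Finset.mul_sum]
    rw [hT0, hT2]
    simp
    ring
  rw [Fintype.sum_prod_type]
  have hsum : ∀ f : Fin (m + 1) → Fin n, ∑ y : Fin (m + 1) → Fin n,
      ∏ t, (edgeWeight α β S T (f t) (y t) * edgeWeight α β S T (f (t + 1)) (y t)) =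
      (n : ℝ) ^ (m + 1) * ∏ t, (1 + γ ^ 2 * (β * (1 - β)) * h (f t) * h (f (t + 1))) := by
    intro f
    have := Finset.prod_univ_sum (fun _ : Fin (m + 1) => (Finset.univ : Finset (Fin n)))
      (fun t w => edgeWeight α β S T (f t) w * edgeWeight α β S T (f (t + 1)) w)
    rw [Fintype.piFinset_univ] at this
    rw [← this]
    simp only [hin, Finset.prod_mul_distrib]
    simp
  simp only [hsum]
  rw [← Finset.mul_sum, sum_one_add_mul_kernel n m _ _ h hS0 hS2, ← mul_assoc, ← pow_add, del,
    Nat.mul_div_cancel_left _ two_pos, ← two_mul]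
  congr 3
  rw [hγ]
  field_simp

/-! ### Overlapping tours -/

/-- The edges of a tour as a set of triples. -/
def Tour.edges {d n : ℕ} {J : Type} [Fintype J] (s : Equiv.Perm J) (p : Tour d n J) :
    Finset (Fin d × Fin n × Fin n) :=
  Finset.univ.image (p.edge s)

/-- A vertex set each of whose vertices is in at least two edges has at most as many vertices as
there are edges; if the degrees are not all two, the inequality is strict. -/
theorem two_mul_card_image_le {E V J : Type} [Fintype J] [DecidableEq E] [DecidableEq V]
    (F : Finset E) (f : E → V) (v : J → V) (hmem : ∀ e ∈ F, ∃ t, f e = v t)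
    (hdeg : ∀ t, 2 ≤ (F.filter fun e => f e = v t).card) :
    2 * (Finset.univ.image v).card ≤ F.card ∧
      (F.card ≤ 2 * (Finset.univ.image v).card → ∀ t, (F.filter fun e => f e = v t).card = 2) := by
  have hsum : F.card = ∑ y ∈ Finset.univ.image v, (F.filter fun e => f e = y).card := by
    refine Finset.card_eq_sum_card_fiberwise fun e he => ?_
    obtain ⟨t, ht⟩ := hmem e he
    simp [ht]
  have hdeg' : ∀ y ∈ Finset.univ.image v, 2 ≤ (F.filter fun e => f e = y).card := by
    intro y hy
    obtain ⟨t, -, rfl⟩ := Finset.mem_image.1 hy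
    exact hdeg t
  have hle : 2 * (Finset.univ.image v).card ≤ F.card := by
    rw [hsum, mul_comm, ← smul_eq_mul, ← Finset.sum_const]
    exact Finset.sum_le_sum hdeg'
  refine ⟨hle, fun h t => ?_⟩
  have heq : ∑ y ∈ Finset.univ.image v, 2 =
      ∑ y ∈ Finset.univ.image v, (F.filter fun e => f e = y).card := by
    rw [← hsum, Finset.sum_const, smul_eq_mul, mul_comm]
    omega
  exact ((Finset.sum_eq_sum_iff_of_le hdeg').1 heq (v t)
    (Finset.mem_image_of_mem _ (Finset.mem_univ t))).symm

namespace Tour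

variable {d n : ℕ} {J : Type} [Fintype J]

theorem edge_mem_edges (s : Equiv.Perm J) (p : Tour d n J) (x : J × Bool) :
    p.edge s x ∈ p.edges s := Finset.mem_image_of_mem _ (Finset.mem_univ _)

/-- If the union of the tours has no more edges than vertices, all degrees are two. -/
theorem eq_edge_of_card_edges_le {s : Equiv.Perm J} {p : Tour d n J} (hp : p.Proper s)
    (hcard : (p.edges s).card ≤
      (Finset.univ.image p.left).card + (Finset.univ.image p.right).card) :
    (∀ e ∈ p.edges s, ∀ t, e.2.1 = p.left t →
      e = p.edge s (t, false) ∨ e = p.edge s (s.symm t, true)) ∧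
    (∀ e ∈ p.edges s, ∀ t, e.2.2 = p.right t →
      e = p.edge s (t, false) ∨ e = p.edge s (t, true)) := by
  have hl : ∀ t, ({p.edge s (t, false), p.edge s (s.symm t, true)} :
      Finset (Fin d × Fin n × Fin n)) ⊆ (p.edges s).filter fun e => e.2.1 = p.left t := by
    intro t e he
    rw [Finset.mem_filter]
    rcases Finset.mem_insert.1 he with rfl | he
    · exact ⟨edge_mem_edges _ _ _, rfl⟩
    · rw [Finset.mem_singleton.1 he]
      exact ⟨edge_mem_edges _ _ _, by simp⟩
  have hr : ∀ t, ({p.edge s (t, false), p.edge s (t, true)} :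
      Finset (Fin d × Fin n × Fin n)) ⊆ (p.edges s).filter fun e => e.2.2 = p.right t := by
    intro t e he
    rw [Finset.mem_filter]
    rcases Finset.mem_insert.1 he with rfl | he
    · exact ⟨edge_mem_edges _ _ _, rfl⟩
    · rw [Finset.mem_singleton.1 he]
      exact ⟨edge_mem_edges _ _ _, rfl⟩
  have hl2 : ∀ t, ({p.edge s (t, false), p.edge s (s.symm t, true)} :
      Finset (Fin d × Fin n × Fin n)).card = 2 := by
    intro t
    refine Finset.card_pair fun h => ?_
    have := (hp (s.symm t)).2
    rw [Equiv.apply_symm_apply] at this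
    exact this (congrArg Prod.fst h).symm
  have hr2 : ∀ t, ({p.edge s (t, false), p.edge s (t, true)} :
      Finset (Fin d × Fin n × Fin n)).card = 2 := fun t =>
    Finset.card_pair fun h => (hp t).1 (congrArg Prod.fst h)
  -- Each side separately has at most half as many vertices as there are edges, so the assumed bound
  -- forces equality on both sides.
  obtain ⟨hL1, hL2⟩ := two_mul_card_image_le (p.edges s) (fun e => e.2.1) p.left (by
    intro e he
    obtain ⟨⟨t, b⟩, -, rfl⟩ := Finset.mem_image.1 he
    cases b
    · exact ⟨t, rfl⟩
    · exact ⟨s t, rfl⟩) (fun t => hl2 t ▸ Finset.card_le_card (hl t))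
  obtain ⟨hR1, hR2⟩ := two_mul_card_image_le (p.edges s) (fun e => e.2.2) p.right (by
    intro e he
    obtain ⟨⟨t, b⟩, -, rfl⟩ := Finset.mem_image.1 he
    cases b <;> exact ⟨t, rfl⟩) (fun t => hr2 t ▸ Finset.card_le_card (hr t))
  constructor
  · intro e he t ht
    have := Finset.eq_of_subset_of_card_le (hl t) (by rw [hl2, hL2 (by omega)])
    have hmem : e ∈ (p.edges s).filter fun e => e.2.1 = p.left t := Finset.mem_filter.2 ⟨he, ht⟩
    rw [← this] at hmem
    simpa using hmem
  · intro e he t ht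
    have := Finset.eq_of_subset_of_card_le (hr t) (by rw [hr2, hR2 (by omega)])
    have hmem : e ∈ (p.edges s).filter fun e => e.2.2 = p.right t := Finset.mem_filter.2 ⟨he, ht⟩
    rw [← this] at hmem
    simpa using hmem

end Tour

/-- Positions in a family of cycles, the `x`-th of which has length `2 (j x + 1)`. -/
abbrev Positions {ι : Type} (j : ι → ℕ) : Type := Σ x, Fin (j x + 1)

/-- The successor on each cycle of a family. -/
def familySucc {ι : Type} (j : ι → ℕ) : Equiv.Perm (Positions j) :=
  Equiv.sigmaCongrRight fun x => succPerm (j x)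

@[simp] theorem familySucc_apply {ι : Type} (j : ι → ℕ) (x : ι) (t : Fin (j x + 1)) :
    familySucc j ⟨x, t⟩ = ⟨x, t + 1⟩ := rfl

@[simp] theorem familySucc_symm_apply {ι : Type} (j : ι → ℕ) (x : ι) (t : Fin (j x + 1)) :
    (familySucc j).symm ⟨x, t⟩ = ⟨x, t - 1⟩ := by
  rw [Equiv.symm_apply_eq, familySucc_apply, sub_add_cancel]

namespace Tour

variable {d n : ℕ} {ι : Type} {j : ι → ℕ}

/-- The `x`-th member of a family. -/
def comp (p : Tour d n (Positions j)) (x : ι) : Tour d n (Fin (j x + 1)) :=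
  ⟨fun t => p.left ⟨x, t⟩, fun t => p.right ⟨x, t⟩, fun t => p.fwd ⟨x, t⟩, fun t => p.back ⟨x, t⟩⟩

theorem edge_comp (p : Tour d n (Positions j)) (x : ι) (y : Fin (j x + 1) × Bool) :
    (p.comp x).edge (succPerm (j x)) y = p.edge (familySucc j) (⟨x, y.1⟩, y.2) := by
  obtain ⟨t, b⟩ := y
  cases b <;> rfl

/-- When all degrees are two, both edges at a vertex of cycle `x` belong to cycle `x`; a cycle that
meets it can never leave it. -/
theorem edges_comp_subset_of_meet [Fintype ι] {p : Tour d n (Positions j)}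
    (hp : p.Proper (familySucc j))
    (hcard : (p.edges (familySucc j)).card ≤
      (Finset.univ.image p.left).card + (Finset.univ.image p.right).card) {x y : ι}
    {a : Fin (j x + 1)} {b : Fin (j y + 1)} (h : p.left ⟨x, a⟩ = p.left ⟨y, b⟩) :
    (p.comp y).edges (succPerm (j y)) ⊆ (p.comp x).edges (succPerm (j x)) := by
  obtain ⟨hL, hR⟩ := eq_edge_of_card_edges_le hp hcard
  have hmem : ∀ t c, p.edge (familySucc j) (⟨x, t⟩, c) ∈ (p.comp x).edges (succPerm (j x)) :=
    fun t c => (edge_comp p x (t, c)) ▸ edge_mem_edges _ _ _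
  have hleft : ∀ e ∈ (p.comp x).edges (succPerm (j x)), ∃ τ, e.2.1 = p.left ⟨x, τ⟩ := by
    intro e he
    obtain ⟨⟨t, c⟩, -, rfl⟩ := Finset.mem_image.1 he
    cases c
    · exact ⟨t, rfl⟩
    · exact ⟨t + 1, rfl⟩
  have hright : ∀ e ∈ (p.comp x).edges (succPerm (j x)), ∃ τ, e.2.2 = p.right ⟨x, τ⟩ := by
    intro e he
    obtain ⟨⟨t, c⟩, -, rfl⟩ := Finset.mem_image.1 he
    cases c <;> exact ⟨t, rfl⟩
  have hstep : ∀ t : Positions j, (∃ τ, p.left t = p.left ⟨x, τ⟩) →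
      p.edge (familySucc j) (t, false) ∈ (p.comp x).edges (succPerm (j x)) ∧
      p.edge (familySucc j) (t, true) ∈ (p.comp x).edges (succPerm (j x)) := by
    rintro t ⟨τ, hτ⟩
    have h1 : p.edge (familySucc j) (t, false) ∈ (p.comp x).edges (succPerm (j x)) := by
      rcases hL _ (edge_mem_edges _ p (t, false)) ⟨x, τ⟩ hτ with h | h
      · rw [h]; exact hmem _ _
      · rw [h, familySucc_symm_apply]; exact hmem _ _
    refine ⟨h1, ?_⟩
    obtain ⟨τ', hτ'⟩ := hright _ h1
    rcases hR _ (edge_mem_edges _ p (t, true)) ⟨x, τ'⟩ hτ' with h | h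
    · rw [h]; exact hmem _ _
    · rw [h]; exact hmem _ _
  -- The induction is on the displacement from the meeting point `b`.
  have hall : ∀ r : Fin (j y + 1), ∃ τ, p.left ⟨y, b + r⟩ = p.left ⟨x, τ⟩ := by
    intro r
    induction r using Fin.induction with
    | zero => exact ⟨a, by rw [add_zero, h]⟩
    | succ r ih =>
      have := hleft _ (hstep _ ih).2
      rw [← Fin.coeSucc_eq_succ, ← add_assoc]
      exact this
  intro e he
  obtain ⟨⟨t, c⟩, -, rfl⟩ := Finset.mem_image.1 he
  have ht := hall (t - b)
  rw [add_sub_cancel] at ht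
  rw [edge_comp]
  cases c
  · exact (hstep _ ht).1
  · exact (hstep _ ht).2

theorem edgeSet_eq_image_edges {J : Type} [Fintype J] (s : Equiv.Perm J) (p : Tour d n J) :
    p.edgeSet s = (p.edges s).image fun e => (e.1, e.2.1) := by
  rw [edges, Finset.image_image]
  rfl

/-- Distinct cycles that meet span more edges than vertices. -/
theorem card_vertices_lt_card_edges [Fintype ι] {p : Tour d n (Positions j)}
    (hp : p.Proper (familySucc j)) (hl : ∀ x, Function.Injective (p.comp x).left)
    (hr : ∀ x, Function.Injective (p.comp x).right)
    (hne : ∀ x y, x ≠ y → (p.comp x).edgeSet (succPerm _) ≠ (p.comp y).edgeSet (succPerm _))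
    (hmeet : ¬ (Function.Injective p.left ∧ Function.Injective p.right)) :
    (Finset.univ.image p.left).card + (Finset.univ.image p.right).card <
      (p.edges (familySucc j)).card := by
  by_contra hcard
  rw [not_lt] at hcard
  have hdisj : ∀ x y, x ≠ y → ∀ a b, p.left ⟨x, a⟩ ≠ p.left ⟨y, b⟩ := by
    intro x y hxy a b h
    refine hne x y hxy ?_
    rw [edgeSet_eq_image_edges, edgeSet_eq_image_edges]
    rw [Finset.Subset.antisymm (edges_comp_subset_of_meet hp hcard h.symm)
      (edges_comp_subset_of_meet hp hcard h)]
  refine hmeet ⟨?_, ?_⟩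
  · rintro ⟨x, a⟩ ⟨y, b⟩ h
    by_cases hxy : x = y
    · subst hxy
      rw [hl x h]
    · exact absurd h (hdisj x y hxy a b)
  · rintro ⟨x, a⟩ ⟨y, b⟩ h
    by_cases hxy : x = y
    · subst hxy
      rw [hr x h]
    · exfalso
      -- Cycles meeting in `V₂` share an edge, as degrees are two, and hence also meet in `V₁`.
      rcases (eq_edge_of_card_edges_le hp hcard).2 _ (edge_mem_edges _ p (⟨x, a⟩, false)) ⟨y, b⟩ h
        with h' | h'
      · exact hdisj x y hxy a b (congrArg (fun e => e.2.1) h')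
      · exact hdisj x y hxy a (b + 1) (congrArg (fun e => e.2.1) h')

end Tour

/-! ### Families of tours and factorial moments of cycle counts -/

namespace Tour

variable {d n : ℕ} {ι : Type} {j : ι → ℕ}

/-- A family of tours is a choice of its members. -/
def familyEquiv (d n : ℕ) (j : ι → ℕ) :
    Tour d n (Positions j) ≃ ∀ x, Tour d n (Fin (j x + 1)) where
  toFun p x := p.comp x
  invFun q := ⟨fun t => (q t.1).left t.2, fun t => (q t.1).right t.2, fun t => (q t.1).fwd t.2,
    fun t => (q t.1).back t.2⟩

/-- A family of tours of pairwise distinct cycles. -/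
def IsFamily (σ : Matchings d n) (p : Tour d n (Positions j)) : Prop :=
  (∀ x, (p.comp x).IsTour σ (succPerm (j x))) ∧
    ∀ x y, x ≠ y → (p.comp x).edgeSet (succPerm _) ≠ (p.comp y).edgeSet (succPerm _)

/-- The conditions for a family of tours of distinct cycles that do not involve the matchings. -/
structure IsPattern (p : Tour d n (Positions j)) : Prop where
  proper : p.Proper (familySucc j)
  left_inj : ∀ x, Function.Injective (p.comp x).left
  right_inj : ∀ x, Function.Injective (p.comp x).right
  edgeSet_ne : ∀ x y, x ≠ y → (p.comp x).edgeSet (succPerm _) ≠ (p.comp y).edgeSet (succPerm _)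

theorem proper_iff_comp (p : Tour d n (Positions j)) :
    p.Proper (familySucc j) ↔ ∀ x, (p.comp x).Proper (succPerm (j x)) :=
  ⟨fun h x t => h ⟨x, t⟩, fun h t => h t.1 t.2⟩

/-- This isolates the dependence on `σ` in the presence of the edges, which allows summation over
outcomes first. -/
theorem isFamily_iff [Fintype ι] (σ : Matchings d n) (p : Tour d n (Positions j)) :
    p.IsFamily σ ↔ p.IsPattern ∧ Contains σ (p.edges (familySucc j)) := by
  constructor
  · rintro ⟨h1, h2⟩
    refine ⟨⟨(proper_iff_comp p).2 fun x => (h1 x).proper, fun x => (h1 x).left_inj,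
      fun x => (h1 x).right_inj, h2⟩, ?_⟩
    intro e he
    obtain ⟨⟨⟨x, t⟩, b⟩, -, rfl⟩ := Finset.mem_image.1 he
    have := (h1 x).present (t, b)
    rwa [edge_comp] at this
  · rintro ⟨h1, h2⟩
    refine ⟨fun x => ⟨h1.left_inj x, h1.right_inj x, (proper_iff_comp p).1 h1.proper x, ?_⟩,
      h1.edgeSet_ne⟩
    intro y
    rw [edge_comp]
    exact h2 _ (edge_mem_edges _ _ _)

theorem isPattern_of_injective {p : Tour d n (Positions j)} (hp : p.Proper (familySucc j))
    (hl : Function.Injective p.left) (hr : Function.Injective p.right) : p.IsPattern where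
  proper := hp
  left_inj x := hl.comp sigma_mk_injective
  right_inj x := hr.comp sigma_mk_injective
  edgeSet_ne x y hxy h := by
    have h1 := (mem_edgeSet (succPerm _) (p.comp x) 0).1
    rw [h] at h1
    obtain ⟨⟨t, b⟩, -, hb⟩ := Finset.mem_image.1 h1
    have h2 := congrArg Prod.snd hb
    cases b
    · exact hxy (congrArg Sigma.fst (hl h2)).symm
    · exact hxy (congrArg Sigma.fst (hl h2)).symm

theorem edge_injective {J : Type} {s : Equiv.Perm J} {p : Tour d n J}
    (hl : Function.Injective p.left) (hp : p.Proper s) : Function.Injective (p.edge s) :=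
  fun x y h => edge_key_injective hl hp (by simp only [h])

theorem isPartialMatching_edges {J : Type} [Fintype J] {s : Equiv.Perm J} {p : Tour d n J}
    (hp : p.Proper s) (hl : Function.Injective p.left) (hr : Function.Injective p.right) :
    IsPartialMatching (p.edges s) := by
  intro e he e' he' hk huw
  obtain ⟨⟨t, b⟩, -, rfl⟩ := Finset.mem_image.1 he
  obtain ⟨⟨t', b'⟩, -, rfl⟩ := Finset.mem_image.1 he'
  rcases huw with h | h
  · rw [edge_key_injective hl hp (Prod.ext hk h)]
  · have : t = t' := by cases b <;> cases b' <;> exact hr h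
    subst this
    cases b <;> cases b'
    · rfl
    · exact absurd hk (hp t).1
    · exact absurd hk.symm (hp t).1
    · rfl

theorem card_edges {J : Type} [Fintype J] {s : Equiv.Perm J} {p : Tour d n J}
    (hp : p.Proper s) (hl : Function.Injective p.left) :
    (p.edges s).card = 2 * Fintype.card J := by
  rw [edges, Finset.card_image_of_injective _ (edge_injective hl hp), Finset.card_univ,
    Fintype.card_prod, Fintype.card_bool, mul_comm]

/-- The product of the weights of the edges, with multiplicity. -/
def weight {J : Type} [Fintype J] (α β : ℝ) (S T : Finset (Fin n)) (s : Equiv.Perm J)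
    (p : Tour d n J) : ℝ :=
  ∏ t, (edgeWeight α β S T (p.left t) (p.right t) * edgeWeight α β S T (p.left (s t)) (p.right t))

theorem prod_edges {J : Type} [Fintype J] {s : Equiv.Perm J} {p : Tour d n J}
    (hp : p.Proper s) (hl : Function.Injective p.left) (α β : ℝ) (S T : Finset (Fin n)) :
    ∏ e ∈ p.edges s, edgeWeight α β S T e.2.1 e.2.2 = p.weight α β S T s := by
  rw [edges, Finset.prod_image (edge_injective hl hp).injOn, Fintype.prod_prod_type]
  refine Finset.prod_congr rfl fun t _ => ?_
  rw [Fintype.prod_bool, mul_comm]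
  rfl

theorem abs_weight_le {J : Type} [Fintype J] {α β : ℝ} (hα : 0 ≤ α) (hβ : 0 ≤ β)
    (hαβ : α + β < 1) (S T : Finset (Fin n)) (s : Equiv.Perm J) (p : Tour d n J) :
    |p.weight α β S T s| ≤ (1 + 1 / ((1 - α) * (1 - β))) ^ (2 * Fintype.card J) := by
  have hP : 0 < (1 - α) * (1 - β) := mul_pos (by linarith) (by linarith)
  rw [weight, Finset.abs_prod, pow_mul, ← Finset.card_univ, ← Finset.prod_const]
  refine Finset.prod_le_prod (fun _ _ => abs_nonneg _) fun t _ => ?_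
  rw [abs_mul, pow_two]
  exact mul_le_mul (abs_typeWeight_le hα hβ hαβ _ _) (abs_typeWeight_le hα hβ hαβ _ _)
    (abs_nonneg _) (by positivity)

/-- Cycles of different lengths have edge sets of different sizes, so distinctness is a condition
within each length only and the count factorises. -/
theorem card_isFamily (σ : Matchings d n) (k : ℕ) (m : Fin k → ℕ) :
    Nat.card {p : Tour d n (Positions fun x : Σ i : Fin k, Fin (m i) => (x.1 : ℕ)) //
      p.IsFamily σ} =
      ∏ i : Fin k, (2 * ((i : ℕ) + 1)) ^ m i *
        (numCycles (2 * ((i : ℕ) + 1)) σ).descFactorial (m i) := by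
  rw [← Finset.prod_congr rfl fun (i : Fin k) _ => card_injective_tours (m := (i : ℕ)) (k := m i) σ,
    ← Nat.card_pi]
  refine Nat.card_congr ?_
  exact
    { toFun := fun p i => ⟨fun t => p.1.comp ⟨i, t⟩, fun t => p.2.1 ⟨i, t⟩, fun t t' h => by
        by_contra hne
        exact p.2.2 ⟨i, t⟩ ⟨i, t'⟩ (fun h' => hne (by simpa using h')) h⟩
      invFun := fun Q => ⟨(familyEquiv d n _).symm fun x => (Q x.1).1 x.2, by
        refine ⟨fun x => (Q x.1).2.1 x.2, ?_⟩
        rintro ⟨i, t⟩ ⟨i', t'⟩ hne h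
        change ((Q i).1 t).edgeSet (succPerm _) = ((Q i').1 t').edgeSet (succPerm _) at h
        have hi : i = i' := by
          have h1 := congrArg Finset.card h
          rw [card_edgeSet ((Q i).2.1 t).left_inj ((Q i).2.1 t).proper,
            card_edgeSet ((Q i').2.1 t').left_inj ((Q i').2.1 t').proper, Fintype.card_fin,
            Fintype.card_fin] at h1
          exact Fin.ext (by omega)
        subst hi
        exact hne (by rw [(Q i).2.2 h])⟩
      left_inv := fun p => rfl
      right_inv := fun Q => rfl }

end Tour

/-! ### The total weight of all patterns -/

theorem card_colour_pairs (d m : ℕ) :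
    Nat.card {c : (Fin (m + 1) → Fin d) × (Fin (m + 1) → Fin d) //
      ∀ t, c.1 t ≠ c.2 t ∧ c.2 t ≠ c.1 (t + 1)} = properColorings d (2 * (m + 1)) := by
  rw [properColorings, ← Nat.card_eq_fintype_card]
  let E : (Fin (2 * (m + 1)) → Fin d) ≃ (Fin (m + 1) → Fin d) × (Fin (m + 1) → Fin d) :=
    { toFun := fun c => (fun t => c (interleave m (t, false)), fun t => c (interleave m (t, true)))
      invFun := fun q t => if ((interleave m).symm t).2 then q.2 ((interleave m).symm t).1
        else q.1 ((interleave m).symm t).1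
      left_inv := fun c => by
        funext t
        obtain ⟨⟨t, b⟩, rfl⟩ := (interleave m).surjective t
        cases b <;> simp
      right_inv := fun q => by simp }
  refine (Nat.card_congr (E.subtypeEquiv fun c => ?_)).symm
  constructor
  · intro h t
    have h1 := h (interleave m (t, false))
    have h2 := h (interleave m (t, true))
    rw [finRotate_interleave_false] at h1
    rw [finRotate_interleave_true] at h2
    exact ⟨h1, h2⟩
  · intro h t
    obtain ⟨⟨t, b⟩, rfl⟩ := (interleave m).surjective t
    cases b
    · rw [finRotate_interleave_false]
      exact (h t).1
    · rw [finRotate_interleave_true]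
      exact (h t).2

open Classical in
-- Weights ignore the choice of matchings and properness ignores the vertices, so the sum splits
-- into a count of colourings and a sum over walks.
theorem sum_weight_proper {n : ℕ} (d m : ℕ) {α β : ℝ} (hα : 0 ≤ α) (hβ : 0 ≤ β)
    (hαβ : α + β < 1) {S T : Finset (Fin n)} (hS : (S.card : ℝ) = α * n)
    (hT : (T.card : ℝ) = β * n) :
    ∑ p : Tour d n (Fin (m + 1)),
      (if p.Proper (succPerm m) then p.weight α β S T (succPerm m) else 0) =
      (n : ℝ) ^ (2 * (m + 1)) *
        (properColorings d (2 * (m + 1)) * (1 + del α β (2 * (m + 1)))) := by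
  rw [← (Tour.equivProd d n (Fin (m + 1))).symm.sum_comp, Fintype.sum_prod_type]
  have : ∀ q : (Fin (m + 1) → Fin n) × (Fin (m + 1) → Fin n),
      ∑ c : (Fin (m + 1) → Fin d) × (Fin (m + 1) → Fin d),
        (if ((Tour.equivProd d n (Fin (m + 1))).symm (q, c)).Proper (succPerm m) then
          ((Tour.equivProd d n (Fin (m + 1))).symm (q, c)).weight α β S T (succPerm m) else 0) =
      properColorings d (2 * (m + 1)) *
        ∏ t, (edgeWeight α β S T (q.1 t) (q.2 t) * edgeWeight α β S T (q.1 (t + 1)) (q.2 t)) := by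
    intro q
    rw [← Finset.sum_filter]
    have e : ∀ c : (Fin (m + 1) → Fin d) × (Fin (m + 1) → Fin d),
      ((Tour.equivProd d n (Fin (m + 1))).symm (q, c)).weight α β S T (succPerm m) =
        ∏ t, (edgeWeight α β S T (q.1 t) (q.2 t) * edgeWeight α β S T (q.1 (t + 1)) (q.2 t)) :=
      fun c => rfl
    simp only [e]
    rw [Finset.sum_const, nsmul_eq_mul, ← card_colour_pairs, Nat.card_eq_fintype_card,
      Fintype.card_subtype]
    congr 3
    ext c
    simp only [Finset.mem_filter]
    rfl
  simp only [this]
  rw [← Finset.mul_sum, sum_edgeWeight_walks m hα hβ hαβ hS hT]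
  ring

theorem card_positions {ι : Type} [Fintype ι] (j : ι → ℕ) :
    Fintype.card (Positions j) = ∑ x, (j x + 1) := by
  simp [Fintype.card_sigma]

open Classical in
-- Allowing vertices to coincide makes the sum factor exactly over the members; overlapping families
-- are dealt with as an error term.
theorem sum_weight_family {n : ℕ} {ι : Type} [Fintype ι] [DecidableEq ι] (d : ℕ) (j : ι → ℕ)
    {α β : ℝ} (hα : 0 ≤ α) (hβ : 0 ≤ β) (hαβ : α + β < 1) {S T : Finset (Fin n)}
    (hS : (S.card : ℝ) = α * n) (hT : (T.card : ℝ) = β * n) :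
    ∑ p : Tour d n (Positions j),
      (if p.Proper (familySucc j) then p.weight α β S T (familySucc j) else 0) =
      (n : ℝ) ^ (2 * Fintype.card (Positions j)) *
        ∏ x, (properColorings d (2 * (j x + 1)) * (1 + del α β (2 * (j x + 1)))) := by
  have hterm : ∀ p : Tour d n (Positions j),
      (if p.Proper (familySucc j) then p.weight α β S T (familySucc j) else 0) =
      ∏ x, if (Tour.familyEquiv d n j p x).Proper (succPerm (j x)) then
        (Tour.familyEquiv d n j p x).weight α β S T (succPerm (j x)) else 0 := by
    intro p
    rw [Finset.prod_ite_zero]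
    simp only [Finset.mem_univ, forall_const]
    refine if_congr (Tour.proper_iff_comp p) ?_ rfl
    rw [Tour.weight, Fintype.prod_sigma]
    rfl
  simp only [hterm]
  rw [(Tour.familyEquiv d n j).sum_comp fun q => ∏ x, if (q x).Proper (succPerm (j x)) then
        (q x).weight α β S T (succPerm (j x)) else 0]
  have := Finset.prod_univ_sum
    (fun x : ι => (Finset.univ : Finset (Tour d n (Fin (j x + 1)))))
    (fun x q => if q.Proper (succPerm (j x)) then q.weight α β S T (succPerm (j x)) else (0 : ℝ))
  rw [Fintype.piFinset_univ] at this
  rw [← this]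
  simp only [sum_weight_proper d _ hα hβ hαβ hS hT]
  rw [Finset.prod_mul_distrib, Finset.prod_pow_eq_pow_sum, card_positions, Finset.mul_sum]

/-! ### Asymptotics of the joint factorial moments -/

/-- A crude bound for overlapping families: a set of edges contained in some outcome is a partial
matching, and otherwise the count is zero. -/
theorem eventually_card_outcomes_le {d : ℕ} {α β : ℝ} (hα : 0 ≤ α) (hβ : 0 ≤ β)
    (hαβ : α + β < 1) (N : ℕ) :
    ∀ᶠ n : ℕ in atTop, ∀ S T : Finset (Fin n), (S.card : ℝ) = α * n → (T.card : ℝ) = β * n →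
      ∀ F : Finset (Fin d × Fin n × Fin n), F.card ≤ N →
        (n : ℝ) ^ F.card * ((outcomes S T F).card : ℝ) ≤
          ((1 + 1 / ((1 - α) * (1 - β))) ^ N + 1) *
            (outcomes S T (∅ : Finset (Fin d × Fin n × Fin n))).card := by
  have hP : 0 < (1 - α) * (1 - β) := mul_pos (by linarith) (by linarith)
  have hB1 : 1 ≤ 1 + 1 / ((1 - α) * (1 - β)) := by
    have : 0 < 1 / ((1 - α) * (1 - β)) := by positivity
    linarith
  have hev : ∀ᶠ n : ℕ in atTop, ∀ M : Fin (N + 1), ∀ S T : Finset (Fin n),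
      (S.card : ℝ) = α * n → (T.card : ℝ) = β * n →
      ∀ F : Finset (Fin d × Fin n × Fin n), F.card = M → IsPartialMatching F →
        |(n : ℝ) ^ (M : ℕ) * ((outcomes S T F).card : ℝ) -
          (∏ e ∈ F, edgeWeight α β S T e.2.1 e.2.2) *
            (outcomes S T (∅ : Finset (Fin d × Fin n × Fin n))).card| ≤
          1 * (outcomes S T (∅ : Finset (Fin d × Fin n × Fin n))).card := by
    rw [eventually_all]
    exact fun M => eventually_card_outcomes hα hβ hαβ M one_pos
  filter_upwards [hev] with n hn S T hS hT F hF
  by_cases h0 : (outcomes S T F).card = 0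
  · rw [h0]
    simp only [Nat.cast_zero, mul_zero]
    positivity
  obtain ⟨σ, hσ⟩ := Finset.card_pos.1 (Nat.pos_of_ne_zero h0)
  have hPM := (mem_outcomes.1 hσ).2.isPartialMatching
  have key := (abs_le.1 (hn ⟨F.card, by omega⟩ S T hS hT F rfl hPM)).2
  have hprod : ∏ e ∈ F, edgeWeight α β S T e.2.1 e.2.2 ≤ (1 + 1 / ((1 - α) * (1 - β))) ^ N := by
    refine (le_abs_self _).trans ?_
    rw [Finset.abs_prod]
    refine (Finset.prod_le_prod (fun _ _ => abs_nonneg _)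
      fun e _ => abs_typeWeight_le hα hβ hαβ _ _).trans ?_
    rw [Finset.prod_const]
    exact pow_le_pow_right₀ hB1 hF
  have h2 := mul_le_mul_of_nonneg_right hprod (Nat.cast_nonneg (α := ℝ)
    (outcomes S T (∅ : Finset (Fin d × Fin n × Fin n))).card)
  simp only at key
  linarith

theorem card_image_add_lt {J : Type} [Fintype J] {n : ℕ} {f g : J → Fin n}
    (h : ¬ (Function.Injective f ∧ Function.Injective g)) :
    (Finset.univ.image f).card + (Finset.univ.image g).card < 2 * Fintype.card J := by
  have hf : (Finset.univ.image f).card ≤ Fintype.card J := Finset.card_image_le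
  have hg : (Finset.univ.image g).card ≤ Fintype.card J := Finset.card_image_le
  by_contra hlt
  refine h ⟨?_, ?_⟩
  · rw [← Set.injOn_univ, ← Finset.coe_univ, ← Finset.card_image_iff, Finset.card_univ]
    omega
  · rw [← Set.injOn_univ, ← Finset.coe_univ, ← Finset.card_image_iff, Finset.card_univ]
    omega

/-- The bound does not depend on `n`, so one further factor `1 / n` makes the overlapping families
negligible. -/
theorem sum_tour_inv_pow_le {d n : ℕ} {J : Type} [Fintype J] [DecidableEq J] (hn : 0 < n) :
    ∑ p : Tour d n J, ((n : ℝ) ^ ((Finset.univ.image p.left).card +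
      (Finset.univ.image p.right).card))⁻¹ ≤
      ((Fintype.card J : ℝ) ^ Fintype.card J) ^ 2 * ((d : ℝ) ^ Fintype.card J) ^ 2 := by
  rw [← (Tour.equivProd d n J).symm.sum_comp, Fintype.sum_prod_type]
  simp only [Tour.equivProd, Equiv.coe_fn_symm_mk, Finset.sum_const, Finset.card_univ,
    Fintype.card_prod, Fintype.card_fun, Fintype.card_fin, nsmul_eq_mul]
  rw [← Finset.mul_sum, Fintype.sum_prod_type]
  simp only [pow_add, mul_inv]
  simp only [← Finset.mul_sum, ← Finset.sum_mul]
  have h := sum_inv_pow_card_image_le (J := J) n hn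
  have h0 : 0 ≤ ∑ f : J → Fin n, ((n : ℝ) ^ (Finset.univ.image f).card)⁻¹ :=
    Finset.sum_nonneg fun _ _ => by positivity
  rw [mul_comm]
  push_cast
  rw [← pow_two, ← pow_two]
  gcongr

open Classical in
/-- Summing the number of outcomes over all patterns. -/
theorem eventually_sum_patterns {ι : Type} [Fintype ι] [DecidableEq ι] (d : ℕ) (j : ι → ℕ)
    {α β : ℝ} (hα : 0 ≤ α) (hβ : 0 ≤ β) (hαβ : α + β < 1) {ε : ℝ} (hε : 0 < ε) :
    ∀ᶠ n : ℕ in atTop, ∀ S T : Finset (Fin n), (S.card : ℝ) = α * n → (T.card : ℝ) = β * n →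
      |∑ p : Tour d n (Positions j), (if p.IsPattern then
          ((outcomes S T (p.edges (familySucc j))).card : ℝ) else 0) -
        (∏ x, (properColorings d (2 * (j x + 1)) * (1 + del α β (2 * (j x + 1))))) *
          (outcomes S T (∅ : Finset (Fin d × Fin n × Fin n))).card| ≤
        ε * (outcomes S T (∅ : Finset (Fin d × Fin n × Fin n))).card := by
  set c := Fintype.card (Positions j) with hc
  set N := 2 * c with hN
  set B : ℝ := 1 + 1 / ((1 - α) * (1 - β)) with hB
  have hP : 0 < (1 - α) * (1 - β) := mul_pos (by linarith) (by linarith)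
  have hB0 : 0 < B := by positivity
  -- `D` counts all choices of matchings. In `K`, `B ^ N + 1` bounds the outcomes of an overlapping
  -- pattern and `B ^ N` its weight.
  set D : ℝ := ((d : ℝ) ^ c) ^ 2 with hD
  set K : ℝ := (B ^ N + 1) + B ^ N with hK
  have hK0 : 0 < K := by positivity
  set R : ℝ := K * (((c : ℝ) ^ c) ^ 2 * D) with hR
  set ε₁ : ℝ := ε / (2 * (D + 1)) with hε₁
  have hε₁0 : 0 < ε₁ := by positivity
  have hlim : ∀ᶠ n : ℕ in atTop, R / n < ε / 2 :=
    (tendsto_const_div_atTop_nhds_zero_nat R).eventually_lt_const (by positivity)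
  filter_upwards [eventually_card_outcomes (d := d) hα hβ hαβ N hε₁0,
    eventually_card_outcomes_le (d := d) hα hβ hαβ N, hlim, eventually_gt_atTop 0]
    with n h1 h2 h3 hn S T hS hT
  have hn0 : (0 : ℝ) < n := by exact_mod_cast hn
  have hn1 : (1 : ℝ) ≤ n := by exact_mod_cast hn
  set W₀ : ℝ := ((outcomes S T (∅ : Finset (Fin d × Fin n × Fin n))).card : ℝ)
  have hW₀ : 0 ≤ W₀ := Nat.cast_nonneg _
  have hsum := sum_weight_family d j hα hβ hαβ hS hT
  set Λ := ∏ x, ((properColorings d (2 * (j x + 1)) : ℝ) * (1 + del α β (2 * (j x + 1))))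
  have hΛ : Λ * W₀ = ∑ p : Tour d n (Positions j),
      (if p.Proper (familySucc j) then
        ((n : ℝ) ^ N)⁻¹ * p.weight α β S T (familySucc j) * W₀ else 0) := by
    have e : ∀ p : Tour d n (Positions j), (if p.Proper (familySucc j) then
        ((n : ℝ) ^ N)⁻¹ * p.weight α β S T (familySucc j) * W₀ else 0) =
        ((n : ℝ) ^ N)⁻¹ * W₀ *
        (if p.Proper (familySucc j) then p.weight α β S T (familySucc j) else 0) := by
      intro p
      split_ifs <;> ring
    simp only [e]
    rw [← Finset.mul_sum, hsum]
    field_simp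
    rw [hN, hc]
  rw [hΛ, ← Finset.sum_sub_distrib]
  -- The first error term is for vertex-disjoint families. The second is for the others, whose edge
  -- count (for patterns) and whose `N` both exceed the number of vertices, gaining the factor `1 /
  -- n`.
  have hterm : ∀ p : Tour d n (Positions j),
      |(if p.IsPattern then ((outcomes S T (p.edges (familySucc j))).card : ℝ) else 0) -
        (if p.Proper (familySucc j) then
          ((n : ℝ) ^ N)⁻¹ * p.weight α β S T (familySucc j) * W₀ else 0)| ≤
      ε₁ * W₀ * ((n : ℝ) ^ N)⁻¹ + K / n * W₀ * ((n : ℝ) ^ ((Finset.univ.image p.left).card +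
        (Finset.univ.image p.right).card))⁻¹ := by
    intro p
    have hpos1 : 0 ≤ ε₁ * W₀ * ((n : ℝ) ^ N)⁻¹ := by positivity
    have hpos2 : 0 ≤ K / n * W₀ * ((n : ℝ) ^ ((Finset.univ.image p.left).card +
        (Finset.univ.image p.right).card))⁻¹ := by positivity
    by_cases hp : p.Proper (familySucc j)
    swap
    · rw [if_neg fun h => hp h.proper, if_neg hp, sub_zero, abs_zero]
      positivity
    rw [if_pos hp]
    by_cases hinj : Function.Injective p.left ∧ Function.Injective p.right
    · rw [if_pos (Tour.isPattern_of_injective hp hinj.1 hinj.2)]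
      have key := h1 S T hS hT _ (Tour.card_edges hp hinj.1)
        (Tour.isPartialMatching_edges hp hinj.1 hinj.2)
      rw [Tour.prod_edges hp hinj.1] at key
      refine le_trans ?_ (le_add_of_nonneg_right hpos2)
      have e : ((outcomes S T (p.edges (familySucc j))).card : ℝ) -
          ((n : ℝ) ^ N)⁻¹ * p.weight α β S T (familySucc j) * W₀ =
          ((n : ℝ) ^ N)⁻¹ * ((n : ℝ) ^ N * ((outcomes S T (p.edges (familySucc j))).card : ℝ) -
            p.weight α β S T (familySucc j) * W₀) := by
        field_simp
      rw [e, abs_mul, abs_of_pos (by positivity), mul_comm]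
      gcongr
    · refine le_trans ?_ (le_add_of_nonneg_left hpos1)
      set v := (Finset.univ.image p.left).card + (Finset.univ.image p.right).card with hv
      have hinv : ∀ M, v < M → ((n : ℝ) ^ M)⁻¹ ≤ (n : ℝ)⁻¹ * ((n : ℝ) ^ v)⁻¹ := by
        intro M hM
        rw [← mul_inv, ← pow_succ']
        gcongr
        exact hM
      have hfirst : (if p.IsPattern then ((outcomes S T (p.edges (familySucc j))).card : ℝ)
          else 0) ≤ (B ^ N + 1) * ((n : ℝ)⁻¹ * ((n : ℝ) ^ v)⁻¹) * W₀ := by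
        split_ifs with hpat
        · have hlt := Tour.card_vertices_lt_card_edges hp hpat.left_inj hpat.right_inj
            hpat.edgeSet_ne hinj
          have hle : (p.edges (familySucc j)).card ≤ N := by
            refine Finset.card_image_le.trans ?_
            rw [Finset.card_univ, Fintype.card_prod, Fintype.card_bool, mul_comm]
          have key := h2 S T hS hT _ hle
          have key' : ((outcomes S T (p.edges (familySucc j))).card : ℝ) ≤
              (B ^ N + 1) * W₀ * ((n : ℝ) ^ (p.edges (familySucc j)).card)⁻¹ := by
            rw [← div_eq_mul_inv, le_div_iff₀ (by positivity), mul_comm]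
            exact key
          refine key'.trans ?_
          rw [mul_right_comm]
          gcongr
          exact hinv _ hlt
        · positivity
      have hfirst0 : 0 ≤ (if p.IsPattern then
          ((outcomes S T (p.edges (familySucc j))).card : ℝ) else 0) := by
        split_ifs <;> positivity
      have hsecond : |((n : ℝ) ^ N)⁻¹ * p.weight α β S T (familySucc j) * W₀| ≤
          B ^ N * ((n : ℝ)⁻¹ * ((n : ℝ) ^ v)⁻¹) * W₀ := by
        rw [abs_mul, abs_mul, abs_of_nonneg hW₀, abs_of_pos (a := ((n : ℝ) ^ N)⁻¹) (by positivity),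
          mul_comm (B ^ N)]
        gcongr
        · exact hinv _ (card_image_add_lt hinj)
        · exact Tour.abs_weight_le hα hβ hαβ S T _ p
      refine (abs_sub _ _).trans ?_
      rw [abs_of_nonneg hfirst0]
      refine (add_le_add hfirst hsecond).trans (le_of_eq ?_)
      rw [hK]
      field_simp
  refine (Finset.abs_sum_le_sum_abs _ _).trans ((Finset.sum_le_sum fun p _ => hterm p).trans ?_)
  rw [Finset.sum_add_distrib, Finset.sum_const, Finset.card_univ,
    Fintype.card_congr (Tour.equivProd d n (Positions j)), nsmul_eq_mul]
  have hcard : (Fintype.card (((Positions j → Fin n) × (Positions j → Fin n)) ×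
      (Positions j → Fin d) × (Positions j → Fin d)) : ℝ) = (n : ℝ) ^ N * D := by
    simp only [Fintype.card_prod, Fintype.card_fun, Fintype.card_fin]
    push_cast
    rw [hN, hD, hc]
    ring
  rw [hcard, ← Finset.mul_sum]
  have hvert := sum_tour_inv_pow_le (d := d) (J := Positions j) hn
  calc (n : ℝ) ^ N * D * (ε₁ * W₀ * ((n : ℝ) ^ N)⁻¹) + K / n * W₀ * _
      ≤ (n : ℝ) ^ N * D * (ε₁ * W₀ * ((n : ℝ) ^ N)⁻¹) + K / n * W₀ * (((c : ℝ) ^ c) ^ 2 * D) := by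
        gcongr
    _ = D * ε₁ * W₀ + R / n * W₀ := by
        rw [hR]
        field_simp
    _ ≤ ε / 2 * W₀ + ε / 2 * W₀ := by
        gcongr
        rw [hε₁, mul_div_assoc', div_le_div_iff₀ (by positivity) (by positivity)]
        have : 0 ≤ D := by positivity
        nlinarith
    _ = ε * W₀ := by ring

open Classical in
theorem sum_card_isFamily {d n : ℕ} {ι : Type} [Fintype ι] [DecidableEq ι] (j : ι → ℕ)
    (S T : Finset (Fin n)) :
    ∑ σ ∈ outcomes S T (∅ : Finset (Fin d × Fin n × Fin n)),
      (Nat.card {p : Tour d n (Positions j) // p.IsFamily σ} : ℝ) =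
      ∑ p : Tour d n (Positions j), (if p.IsPattern then
          ((outcomes S T (p.edges (familySucc j))).card : ℝ) else 0) := by
  have h1 : ∀ σ : Matchings d n, (Nat.card {p : Tour d n (Positions j) // p.IsFamily σ} : ℝ) =
      ∑ p : Tour d n (Positions j), if p.IsFamily σ then (1 : ℝ) else 0 := by
    intro σ
    rw [Nat.card_eq_fintype_card, Fintype.card_subtype, Finset.sum_boole]
  simp only [h1]
  rw [Finset.sum_comm]
  refine Finset.sum_congr rfl fun p _ => ?_
  rw [Finset.sum_boole]
  split_ifs with hp
  · congr 2
    ext σ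
    simp only [Finset.mem_filter, mem_outcomes, Tour.isFamily_iff, hp, true_and]
    simp [Contains]
  · rw [Finset.filter_false_of_mem fun σ _ h => hp ((Tour.isFamily_iff σ p).1 h).1]
    simp

theorem eventually_sum_descFactorial (d : ℕ) {α β : ℝ} (hα : 0 ≤ α) (hβ : 0 ≤ β)
    (hαβ : α + β < 1) (k : ℕ) (m : Fin k → ℕ) {ε : ℝ} (hε : 0 < ε) :
    ∀ᶠ n : ℕ in atTop, ∀ S T : Finset (Fin n), (S.card : ℝ) = α * n → (T.card : ℝ) = β * n →
      |∑ σ ∈ outcomes S T (∅ : Finset (Fin d × Fin n × Fin n)),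
          ∏ i : Fin k, ((evenCycles d n i σ).descFactorial (m i) : ℝ) -
        (∏ i : Fin k, (evenLam d i * (1 + evenDel α β i)) ^ m i) *
          (outcomes S T (∅ : Finset (Fin d × Fin n × Fin n))).card| ≤
        ε * (outcomes S T (∅ : Finset (Fin d × Fin n × Fin n))).card := by
  set j : (Σ i : Fin k, Fin (m i)) → ℕ := fun x => (x.1 : ℕ)
  -- The number of tours per family of cycles; dividing by it turns `r(d, ℓ)` into `λ_ℓ`.
  set c : ℝ := ∏ i : Fin k, (2 * ((i : ℝ) + 1)) ^ m i with hc
  have hc0 : 0 < c := Finset.prod_pos fun i _ => by positivity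
  filter_upwards [eventually_sum_patterns d j hα hβ hαβ (mul_pos hc0 hε)] with n hn S T hS hT
  have key := hn S T hS hT
  rw [← sum_card_isFamily] at key
  have h1 : ∀ σ : Matchings d n, (Nat.card {p : Tour d n (Positions j) // p.IsFamily σ} : ℝ) =
      c * ∏ i : Fin k, ((evenCycles d n i σ).descFactorial (m i) : ℝ) := by
    intro σ
    rw [Tour.card_isFamily, hc, ← Finset.prod_mul_distrib]
    push_cast
    rfl
  have h2 : ∏ x, ((properColorings d (2 * (j x + 1)) : ℝ) * (1 + del α β (2 * (j x + 1)))) =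
      c * ∏ i : Fin k, (evenLam d i * (1 + evenDel α β i)) ^ m i := by
    rw [Fintype.prod_sigma, hc, ← Finset.prod_mul_distrib]
    refine Finset.prod_congr rfl fun i _ => ?_
    simp only [j, Finset.prod_const, Finset.card_univ, Fintype.card_fin]
    rw [← mul_pow, evenLam, evenDel, lam]
    congr 1
    push_cast
    field_simp
  simp only [h1] at key
  rw [h2, ← Finset.mul_sum, mul_assoc, ← mul_sub, abs_mul, abs_of_pos hc0, mul_assoc] at key
  exact le_of_mul_le_mul_left key hc0

/-! ### Averaging over the independent sets -/

open Classical in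
/-- The pairs of vertex sets of the prescribed sizes. -/
def sizedPairs (α β : ℝ) (n : ℕ) : Finset (Finset (Fin n) × Finset (Fin n)) :=
  Finset.univ.filter fun q => (q.1.card : ℝ) = α * n ∧ (q.2.card : ℝ) = β * n

theorem sum_numIndep_mul {d n : ℕ} (α β : ℝ) (f : Matchings d n → ℝ) :
    ∑ σ : Matchings d n, (numIndep α β σ : ℝ) * f σ =
      ∑ q ∈ sizedPairs α β n,
        ∑ σ ∈ outcomes q.1 q.2 (∅ : Finset (Fin d × Fin n × Fin n)), f σ := by
  classical
  have h1 : ∀ σ : Matchings d n, (numIndep α β σ : ℝ) * f σ =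
      ∑ q ∈ sizedPairs α β n, if Avoids q.1 q.2 σ then f σ else 0 := by
    intro σ
    rw [← Finset.sum_filter, Finset.sum_const, nsmul_eq_mul, numIndep]
    congr 2
    rw [← Set.ncard_coe_finset]
    congr 1
    ext q
    rw [Finset.mem_coe, Finset.mem_filter, sizedPairs, Finset.mem_filter]
    simp only [Set.mem_ofPred_eq, Avoids, Finset.mem_univ, true_and, and_assoc]
  simp only [h1]
  rw [Finset.sum_comm]
  refine Finset.sum_congr rfl fun q _ => ?_
  rw [← Finset.sum_filter]
  refine Finset.sum_congr ?_ fun _ _ => rfl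
  ext σ
  simp [mem_outcomes, Contains]

theorem sum_numIndep {d n : ℕ} (α β : ℝ) :
    ∑ σ : Matchings d n, (numIndep α β σ : ℝ) =
      ∑ q ∈ sizedPairs α β n,
        ((outcomes q.1 q.2 (∅ : Finset (Fin d × Fin n × Fin n))).card : ℝ) := by
  simpa using sum_numIndep_mul (d := d) (n := n) α β fun _ => 1

theorem sum_numIndep_pos {d n : ℕ} {α β : ℝ} (hαβ : α + β < 1) (hn : n ∈ admissible α β) :
    0 < ∑ σ : Matchings d n, (numIndep α β σ : ℝ) := by
  obtain ⟨a, b, ha, hb⟩ := hn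
  have hab : a + b ≤ n := by
    have : ((a + b : ℕ) : ℝ) ≤ n := by
      push_cast
      rw [ha, hb, ← add_mul]
      exact mul_le_of_le_one_left (Nat.cast_nonneg n) hαβ.le
    exact_mod_cast this
  obtain ⟨S, -, hS⟩ := Finset.exists_subset_card_eq
    (s := (Finset.univ : Finset (Fin n))) (n := a) (by simp; omega)
  obtain ⟨T, hTS, hT⟩ := Finset.exists_subset_card_eq
    (s := Sᶜ) (n := b) (by rw [Finset.card_compl, Fintype.card_fin, hS]; omega)
  rw [sum_numIndep]
  refine Finset.sum_pos' (fun _ _ => Nat.cast_nonneg _) ⟨(S, T), ?_, ?_⟩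
  · simp [sizedPairs, hS, hT, ha, hb]
  -- With every matching the identity, disjoint index sets `S` and `T` are independent.
  · have : (fun _ => 1 : Matchings d n) ∈
        outcomes S T (∅ : Finset (Fin d × Fin n × Fin n)) := by
      rw [mem_outcomes]
      refine ⟨fun k u hu hT' => ?_, by simp [Contains]⟩
      exact Finset.mem_compl.1 (hTS hT') hu
    exact_mod_cast Finset.card_pos.2 ⟨_, this⟩

theorem expect_numIndep_pos {d n : ℕ} {α β : ℝ} (hαβ : α + β < 1) (hn : n ∈ admissible α β) :
    0 < 𝔼 σ : Matchings d n, (numIndep α β σ : ℝ) := by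
  rw [Fintype.expect_eq_sum_div_card]
  exact div_pos (sum_numIndep_pos hαβ hn) (by exact_mod_cast Fintype.card_pos)

/-- The relative error is uniform in `(S, T)`, so it survives summation over all pairs of the
prescribed sizes. -/
theorem jointFactorialMoments (d : ℕ) {α β : ℝ} (hα : 0 ≤ α) (hβ : 0 ≤ β) (hαβ : α + β < 1) :
    JointFactorialMoments (Ω := Matchings d) (admissibleAtTop α β) (evenCycles d)
      (indepCount d α β) (evenLam d) (evenDel α β) := by
  intro k m
  rw [Metric.tendsto_nhds]
  intro ε hε
  rw [admissibleAtTop, eventually_inf_principal]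
  filter_upwards [eventually_sum_descFactorial d hα hβ hαβ k m (half_pos hε)] with n hn hadm
  have hpos := sum_numIndep_pos (d := d) hαβ hadm
  have hcard : (Fintype.card (Matchings d n) : ℝ) ≠ 0 := by
    exact_mod_cast Fintype.card_ne_zero
  rw [Fintype.expect_eq_sum_div_card, Fintype.expect_eq_sum_div_card,
    div_div_div_cancel_right₀ hcard]
  simp only [indepCount]
  rw [Real.dist_eq, div_sub' hpos.ne', abs_div, abs_of_pos hpos, div_lt_iff₀ hpos]
  refine lt_of_le_of_lt ?_ (mul_lt_mul_of_pos_right (half_lt_self hε) hpos)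
  rw [sum_numIndep_mul, sum_numIndep, Finset.sum_mul, ← Finset.sum_sub_distrib, Finset.mul_sum]
  refine (Finset.abs_sum_le_sum_abs _ _).trans (Finset.sum_le_sum fun q hq => ?_)
  have hq' : (q.1.card : ℝ) = α * n ∧ (q.2.card : ℝ) = β * n := by
    simpa [sizedPairs] using hq
  rw [mul_comm ((outcomes q.1 q.2 (∅ : Finset (Fin d × Fin n × Fin n))).card : ℝ)]
  exact hn q.1 q.2 hq'.1 hq'.2

/-- Take `α = β = 0`: only the empty set is counted, every `n` is admissible, and `δ` vanishes
because its exponent is at least one. -/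
theorem asympIndepPoisson_evenCycles (d : ℕ) :
    AsympIndepPoisson (Ω := Matchings d) atTop (evenCycles d) (evenLam d) := by
  refine asympIndepPoisson_of_factorialMoments _ _ _ fun k m => ?_
  have h := jointFactorialMoments d (le_refl (0 : ℝ)) (le_refl (0 : ℝ)) (by norm_num) k m
  have hadm : admissibleAtTop 0 0 = atTop := by
    have : admissible 0 0 = Set.univ := Set.eq_univ_of_forall fun n => ⟨0, 0, by simp, by simp⟩
    rw [admissibleAtTop, this, principal_univ, inf_top_eq]
  have hY : ∀ n (σ : Matchings d n), indepCount d 0 0 n σ = 1 := by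
    intro n σ
    rw [indepCount, numIndep]
    have : {p : Finset (Fin n) × Finset (Fin n) | (p.1.card : ℝ) = 0 * n ∧
        (p.2.card : ℝ) = 0 * n ∧ ∀ k, ∀ u ∈ p.1, σ k u ∉ p.2} = {(∅, ∅)} := by
      ext ⟨S, T⟩
      simp only [zero_mul, Nat.cast_eq_zero, Finset.card_eq_zero, Set.mem_ofPred_eq,
        Set.mem_singleton_iff, Prod.mk.injEq]
      constructor
      · rintro ⟨h1, h2, -⟩
        exact ⟨h1, h2⟩
      · rintro ⟨rfl, rfl⟩
        simp
    rw [this]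
    simp
  have hδ : ∀ i, evenDel 0 0 i = 0 := by
    intro i
    simp [evenDel, del]
  rw [hadm] at h
  simpa [hY, hδ] using h

theorem tendsto_indep_mul_cycles (d : ℕ) {α β : ℝ} (hα : 0 ≤ α) (hβ : 0 ≤ β) (hαβ : α + β < 1)
    (i : ℕ) :
    Tendsto
      (fun n : ℕ => (𝔼 σ : Matchings d n, (numIndep α β σ : ℝ) *
        (numCycles (2 * (i + 1)) σ : ℝ)) / (𝔼 σ : Matchings d n, (numIndep α β σ : ℝ)))
      (admissibleAtTop α β) (𝓝 (lam d (2 * (i + 1)) * (1 + del α β (2 * (i + 1))))) := by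
  have h := jointFactorialMoments d hα hβ hαβ (i + 1) (Pi.single (Fin.last i) 1)
  rw [Fintype.prod_eq_single (Fin.last i) (by intro j hj; simp [Pi.single_eq_of_ne hj])] at h
  have e : ∀ n (σ : Matchings d n), ∏ x : Fin (i + 1), ((evenCycles d n x σ).descFactorial
      ((Pi.single (Fin.last i) 1 : Fin (i + 1) → ℕ) x) : ℝ) = numCycles (2 * (i + 1)) σ := by
    intro n σ
    rw [Fintype.prod_eq_single (Fin.last i) (by intro j hj; simp [Pi.single_eq_of_ne hj])]
    simp [evenCycles]
  simp only [e] at h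
  simpa [indepCount, evenLam, evenDel] using h

/-! ### The second moment -/

theorem one_le_second_moment_ratio {d n : ℕ} {α β : ℝ} (hαβ : α + β < 1)
    (hn : n ∈ admissible α β) :
    1 ≤ (𝔼 σ : Matchings d n, (numIndep α β σ : ℝ) ^ 2) /
      (𝔼 σ : Matchings d n, (numIndep α β σ : ℝ)) ^ 2 := by
  have hpos := expect_numIndep_pos (d := d) hαβ hn
  rw [one_le_div (by positivity)]
  have hcard : (0 : ℝ) < Fintype.card (Matchings d n) := by exact_mod_cast Fintype.card_pos
  have h := sq_sum_le_card_mul_sum_sq (s := (Finset.univ : Finset (Matchings d n)))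
    (f := fun σ => (numIndep α β σ : ℝ))
  rw [Finset.card_univ] at h
  rw [Fintype.expect_eq_sum_div_card, Fintype.expect_eq_sum_div_card, div_pow,
    div_le_div_iff₀ (by positivity) hcard]
  nlinarith

theorem neBot_admissibleAtTop {α β : ℝ} (hinf : (admissible α β).Infinite) :
    (admissibleAtTop α β).NeBot :=
  frequently_mem_iff_neBot.1 (Nat.frequently_atTop_iff_infinite.2 hinf)

/-- Otherwise the real square root is `0` by convention, and division by zero gives `tau = 0`. By
Cauchy–Schwarz the ratio is at least one along the infinitely many admissible `n`. -/
theorem discriminant_pos_of_secondMomentLimit {d : ℕ} {α β : ℝ} (hαβ : α + β < 1)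
    (hinf : (admissible α β).Infinite) (h : SecondMomentLimit d α β) :
    0 < 1 - α - β - (d - 2) * α * β := by
  by_contra hle
  rw [not_lt] at hle
  have hτ : tau d α β = 0 := by
    rw [tau, Real.sqrt_eq_zero_of_nonpos hle]
    simp
  have := neBot_admissibleAtTop hinf
  have h1 : (1 : ℝ) ≤ tau d α β := by
    refine ge_of_tendsto h ?_
    rw [admissibleAtTop, eventually_inf_principal]
    exact Eventually.of_forall fun n hn => one_le_second_moment_ratio hαβ hn
  linarith

/-- With `D = d - 1`, the term for length `2j` is `(Dq)^{2j} / (2j) + D q^{2j} / (2j)`. Both are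
logarithmic series, and `1 - (Dq)²` and `1 - q²` factor into the expressions in `tau`. -/
theorem hasSum_evenLam_mul_evenDel_sq {d : ℕ} (hd : 3 ≤ d) {α β : ℝ} (hα : 0 ≤ α) (hβ : 0 ≤ β)
    (hαβ : α + β < 1) (hdisc : 0 < 1 - α - β - (d - 2) * α * β) :
    HasSum (fun i => evenLam d i * evenDel α β i ^ 2) (Real.log (tau d α β)) := by
  have hd' : (3 : ℝ) ≤ d := by exact_mod_cast hd
  have h1 : 0 < 1 - α := by linarith
  have h2 : 0 < 1 - β := by linarith
  have hm : 0 ≤ α * β := mul_nonneg hα hβ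
  set P := (1 - α) * (1 - β) with hP
  have hP0 : 0 < P := mul_pos h1 h2
  set q := α * β / P with hq
  have hq0 : 0 ≤ q := div_nonneg hm hP0.le
  -- After multiplication by `P` this is exactly the discriminant condition.
  have hDq : ((d : ℝ) - 1) * q < 1 := by
    rw [hq, mul_div_assoc', div_lt_one hP0, hP]
    nlinarith
  have hDq0 : 0 ≤ ((d : ℝ) - 1) * q := mul_nonneg (by linarith) hq0
  have hq1 : q < 1 := by nlinarith
  have hx1 : |(((d : ℝ) - 1) * q) ^ 2| < 1 := by
    rw [abs_of_nonneg (sq_nonneg _)]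
    exact pow_lt_one₀ hDq0 hDq two_ne_zero
  have hx2 : |q ^ 2| < 1 := by
    rw [abs_of_nonneg (sq_nonneg _)]
    exact pow_lt_one₀ hq0 hq1 two_ne_zero
  have hs := ((Real.hasSum_pow_div_log_of_abs_lt_one hx1).mul_left (1 / 2)).add
    ((Real.hasSum_pow_div_log_of_abs_lt_one hx2).mul_left (((d : ℝ) - 1) / 2))
  have ha : 0 < 1 - α - β + 2 * α * β := by nlinarith
  have hb : 0 < 1 - α - β := by linarith
  have he : 0 < 1 - α - β + d * α * β := by
    have : 0 ≤ d * (α * β) := by positivity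
    nlinarith
  have hPe : 1 - α - β + α * β = P := by rw [hP]; ring
  have hτ : Real.log (tau d α β) = 1 / 2 * -Real.log (1 - (((d : ℝ) - 1) * q) ^ 2) +
      ((d : ℝ) - 1) / 2 * -Real.log (1 - q ^ 2) := by
    have e1 : 1 - (((d : ℝ) - 1) * q) ^ 2 =
        (1 - α - β - (d - 2) * α * β) * (1 - α - β + d * α * β) / P ^ 2 := by
      rw [hq, ← hPe]
      have : 1 - α - β + α * β ≠ 0 := by rw [hPe]; exact hP0.ne'
      field_simp
      ring
    have e2 : 1 - q ^ 2 = (1 - α - β + 2 * α * β) * (1 - α - β) / P ^ 2 := by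
      rw [hq, ← hPe]
      have : 1 - α - β + α * β ≠ 0 := by rw [hPe]; exact hP0.ne'
      field_simp
      ring
    have hs1 := Real.sqrt_pos.2 he
    have hs2 := Real.sqrt_pos.2 hdisc
    have hr1 := Real.rpow_pos_of_pos ha (((d : ℝ) - 1) / 2)
    have hr2 := Real.rpow_pos_of_pos hb (((d : ℝ) - 1) / 2)
    rw [tau, hPe, Real.log_div (by positivity) (by positivity),
      Real.log_mul (by positivity) hs2.ne', Real.log_mul (by positivity) hs1.ne',
      Real.log_mul hr1.ne' hr2.ne', Real.log_rpow ha, Real.log_rpow hb, Real.log_sqrt he.le,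
      Real.log_sqrt hdisc.le, e1, e2, Real.log_div (mul_pos hdisc he).ne' (by positivity),
      Real.log_div (mul_pos ha hb).ne' (by positivity), Real.log_mul hdisc.ne' he.ne',
      Real.log_mul ha.ne' hb.ne', Real.log_pow, Real.log_pow]
    push_cast
    ring
  rw [hτ]
  refine Eq.mp (congrArg (fun f => HasSum f _) (funext fun i => ?_)) hs
  symm
  rw [evenLam, lam, properColorings_eq d i (by omega), evenDel, del,
    Nat.mul_div_cancel_left _ two_pos, ← hP, ← hq,
    ← pow_mul, mul_pow]
  generalize (d : ℝ) - 1 = D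
  push_cast
  field_simp
  ring

theorem tau_pos {d : ℕ} {α β : ℝ} (hα : 0 ≤ α) (hβ : 0 ≤ β) (hαβ : α + β < 1)
    (hdisc : 0 < 1 - α - β - (d - 2) * α * β) : 0 < tau d α β := by
  have hm : 0 ≤ α * β := mul_nonneg hα hβ
  have ha : 0 < 1 - α - β + 2 * α * β := by nlinarith
  have hb : 0 < 1 - α - β := by linarith
  have he : 0 < 1 - α - β + d * α * β := by
    have : 0 ≤ d * (α * β) := by positivity
    nlinarith
  have hP : 0 < 1 - α - β + α * β := by linarith
  have hs1 := Real.sqrt_pos.2 he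
  have hs2 := Real.sqrt_pos.2 hdisc
  have hr1 := Real.rpow_pos_of_pos ha (((d : ℝ) - 1) / 2)
  have hr2 := Real.rpow_pos_of_pos hb (((d : ℝ) - 1) / 2)
  rw [tau]
  positivity

theorem evenLam_pos {d : ℕ} (hd : 3 ≤ d) (i : ℕ) : 0 < evenLam d i := by
  have hd' : (3 : ℝ) ≤ d := by exact_mod_cast hd
  have h1 : 0 < (d : ℝ) - 1 := by linarith
  rw [evenLam, lam, properColorings_eq d i (by omega)]
  positivity

theorem evenDel_nonneg {α β : ℝ} (hα : 0 ≤ α) (hβ : 0 ≤ β) (hαβ : α + β < 1) (i : ℕ) :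
    0 ≤ evenDel α β i := by
  have h1 : 0 < 1 - α := by linarith
  have h2 : 0 < 1 - β := by linarith
  rw [evenDel, del]
  positivity

theorem smallSubgraphConditions {d : ℕ} (hd : 3 ≤ d) {α β : ℝ} (hα : 0 ≤ α) (hβ : 0 ≤ β)
    (hαβ : α + β < 1) (hinf : (admissible α β).Infinite) (h : SecondMomentLimit d α β) :
    SmallSubgraphConditions (Ω := Matchings d) (admissibleAtTop α β) (evenCycles d)
      (indepCount d α β) (evenLam d) (evenDel α β) := by
  have hdisc := discriminant_pos_of_secondMomentLimit hαβ hinf h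
  have hsum := hasSum_evenLam_mul_evenDel_sq hd hα hβ hαβ hdisc
  have hle : admissibleAtTop α β ≤ atTop := inf_le_left
  refine ⟨evenLam_pos hd, fun i => ?_, fun n σ => Nat.cast_nonneg _, ?_, ?_,
    jointFactorialMoments d hα hβ hαβ, hsum.summable, ?_⟩
  · linarith [evenDel_nonneg hα hβ hαβ i]
  · rw [admissibleAtTop, eventually_inf_principal]
    exact Eventually.of_forall fun n hn => expect_numIndep_pos hαβ hn
  · have hP := asympIndepPoisson_evenCycles d
    exact ⟨fun i => (hP.1 i).mono_left hle, fun k a => (hP.2 k a).mono_left hle⟩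
  · intro ε hε
    -- The exponential of the series is `tau` itself, so the second moment condition holds with
    -- equality in the limit.
    rw [hsum.tsum_eq, Real.exp_log (tau_pos hα hβ hαβ hdisc)]
    exact (h.eventually_lt_const (lt_add_of_pos_right _ hε)).mono fun n hn => hn.le

end BipartiteHardCore

end

/-! ### The main theorem. -/

open BipartiteHardCore in
theorem mainTheorem7 (d : ℕ) (hd : 3 ≤ d) (α β : ℝ) (hα : 0 ≤ α) (hβ : 0 ≤ β)
    (hαβ : α + β < 1) (hinf : (admissible α β).Infinite) :
    AsympIndepPoisson (Ω := Matchings d) atTop (evenCycles d) (evenLam d) ∧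
    (∀ ℓ : ℕ, Even ℓ → 2 ≤ ℓ →
      Tendsto
        (fun n : ℕ => (𝔼 σ : Matchings d n, (numIndep α β σ : ℝ) * (numCycles ℓ σ : ℝ)) /
          (𝔼 σ : Matchings d n, (numIndep α β σ : ℝ)))
        (admissibleAtTop α β) (𝓝 (lam d ℓ * (1 + del α β ℓ)))) ∧
    (∀ ℓ : ℕ, Even ℓ → 2 ≤ ℓ →
      1 + del α β ℓ = stepWeight α β ^ ℓ * (transferMatrix α β ^ ℓ).trace / 2) ∧
    JointFactorialMoments (Ω := Matchings d) (admissibleAtTop α β) (evenCycles d)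
      (indepCount d α β) (evenLam d) (evenDel α β) ∧
    (SecondMomentLimit d α β →
      SmallSubgraphConditions (Ω := Matchings d) (admissibleAtTop α β) (evenCycles d)
        (indepCount d α β) (evenLam d) (evenDel α β)) := by
  have hhalf : ∀ ℓ : ℕ, Even ℓ → 2 ≤ ℓ → ∃ i, ℓ = 2 * (i + 1) := by
    rintro ℓ ⟨r, rfl⟩ h
    exact ⟨r - 1, by omega⟩
  refine ⟨asympIndepPoisson_evenCycles d, fun ℓ he h2 => ?_, fun ℓ he h2 => ?_,
    jointFactorialMoments d hα hβ hαβ, smallSubgraphConditions hd hα hβ hαβ hinf⟩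
  · obtain ⟨i, rfl⟩ := hhalf ℓ he h2
    exact tendsto_indep_mul_cycles d hα hβ hαβ i
  · obtain ⟨i, rfl⟩ := hhalf ℓ he h2
    exact one_add_del_eq_trace α β hα hβ hαβ (i + 1)
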